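/- Let $n\ge 0$ and $[n]=\{1,\dots,n\}$. Let $s_1,\dots,s_{n-1}$ be the adjacent transpositions in the symmetric group $S_n$, where products of permutations are composed from right to left. For each $w\in S_n$ fix a reduced decomposition. A permutation $w\in S_n$ is *321-avoiding* if it has no reduced decomposition of the form $\cdots s_is_js_i\cdots$ with $|i-j|=1$. Let $TL_n(2)$ be the $\mathbb C$-algebra generated by $t_1,\dots,t_{n-1}$ subject to $t_i^2=2t_i$, $t_it_jt_i=t_i$ if $|i-j|=1$, and $t_it_j=t_jt_i$ if $|i-j|\ge 2$. For a 321-avoiding $w$ with reduced decomposition $w=s_{i_1}\cdots s_{i_l}$ put $t_w=t_{i_1}\cdots t_{i_l}$. Then the elements $t_w$, for $w\in S_n$ 321-avoiding, form a basis of $TL_n(2)$. For $v\in S_n$ with reduced decomposition $v=s_{i_1}\cdots s_{i_l}$ and $w\in S_n$ 321-avoiding, let $f_w(v)$ be the coefficient of $t_w$ in the expansion of $(t_{i_1}-1)\cdots(t_{i_l}-1)$ in this basis. The *Temperley–Lieb immanant* of an $n\times n$ matrix $X=(x_{ij})$ with entries in a commutative $\mathbb C$-algebra is $$\mathrm{Imm}^{\mathrm{TL}}_w(X)=\sum_{v\in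 S_n}f_w(v)\,x_{1,v(1)}\cdots x_{n,v(n)}.$$ The *Temperley–Lieb diagram* of $t_{i_1}\cdots t_{i_l}$ has the vertices $1,\dots,n$ on its left side and, opposite to them, the vertices $2n,\dots,n+1$ on its right side ($2n+1-i$ is opposite to $i$). It is obtained by stacking the diagrams of $t_{i_1},\dots,t_{i_l}$ from left to right, where in the diagram of $t_i$ the left vertices $i,i+1$ are joined to each other, the right vertices opposite to $i,i+1$ are joined to each other, and every other left vertex is joined to its opposite vertex. The strands of the diagram join the vertices $1,\dots,2n$ in pairs. For $S\subseteq[2n]$ let $\Theta(S)$ be the set of all 321-avoiding $w\in S_n$ such that each strand of the diagram of $t_w$ has one end in $S$ and the other end in $[2n]\setminus S$. For $I,J\subseteq[n]$ of the same cardinality let $\Delta_{I,J}(X)$ be the minor of $X$ with row set $I$ and column set $J$; let $\bar I=[n]\setminus I$, and for $K\subseteq[n]$ let $K^\wedge=\{2n+1-i\mid i\in K\}$. **Theorem.** For any two subsets $I,J\subseteq[n]$ of the same cardinality and $S=J\cup(\bar I)^\wedge$, $$\Delta_{I,J}(X)\cdot\Delta_{\bar I,\bar J}(X)=\sum_{w\in\Theta(S)}\mathrm{Imm}^{\mathrm{TL}}_w(X).$$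 -/

import Mathlib

namespace TLImm

/-! ## Words in the adjacent transpositions

The index set `[n] = {1, …, n}` is `Fin n` and the index set `{1, …, n - 1}` of the generators
is `Fin (n - 1)`, both shifted down by one. -/

/-- The element `i` of `[n]`, for a generator index `i`. -/
def lo {n : ℕ} (i : Fin (n - 1)) : Fin n := ⟨i.1, by omega⟩

/-- The element `i + 1` of `[n]`, for a generator index `i`. -/
def hi {n : ℕ} (i : Fin (n - 1)) : Fin n := ⟨i.1 + 1, by omega⟩

/-- The adjacent transposition `s_i = (i, i + 1)` in `S_n`. -/
def adjSwap {n : ℕ} (i : Fin (n - 1)) : Equiv.Perm (Fin n) := Equiv.swap (lo i) (hi i)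

/-- `|i - j| = 1`. -/
def Adjacent {n : ℕ} (i j : Fin (n - 1)) : Prop := i.1 + 1 = j.1 ∨ j.1 + 1 = i.1

/-- `|i - j| ≥ 2`. -/
def Distant {n : ℕ} (i j : Fin (n - 1)) : Prop := i.1 + 2 ≤ j.1 ∨ j.1 + 2 ≤ i.1

/-- `l = [i₁, …, i_l]` is a reduced decomposition of `w`: the product `s_{i₁} ⋯ s_{i_l}`
(the rightmost factor acts first) is `w`, and no shorter word has product `w`. -/
def IsReducedWord {n : ℕ} (l : List (Fin (n - 1))) (w : Equiv.Perm (Fin n)) : Prop :=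
  (l.map adjSwap).prod = w ∧
    ∀ l' : List (Fin (n - 1)), (l'.map adjSwap).prod = w → l.length ≤ l'.length

theorem exists_word {n : ℕ} (w : Equiv.Perm (Fin n)) :
    ∃ l : List (Fin (n - 1)), (l.map adjSwap).prod = w := by
  cases n with
  | zero => exact ⟨[], Subsingleton.elim _ _⟩
  | succ m =>
    have hw : w ∈ Submonoid.closure
        (Set.range fun i : Fin m ↦ Equiv.swap i.castSucc i.succ) := by
      rw [Equiv.Perm.mclosure_swap_castSucc_succ]; trivial
    induction hw using Submonoid.closure_induction with
    | mem x hx =>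
      obtain ⟨i, rfl⟩ := hx
      exact ⟨[i], mul_one _⟩
    | one => exact ⟨[], rfl⟩
    | mul x y _ _ hx hy =>
      obtain ⟨a, rfl⟩ := hx
      obtain ⟨b, rfl⟩ := hy
      exact ⟨a ++ b, by rw [List.map_append, List.prod_append]⟩

theorem exists_isReducedWord {n : ℕ} (w : Equiv.Perm (Fin n)) :
    ∃ l : List (Fin (n - 1)), IsReducedWord l w := by
  classical
  have h : ∃ k, ∃ l : List (Fin (n - 1)), l.length = k ∧ (l.map adjSwap).prod = w :=
    (exists_word w).elim fun l hl ↦ ⟨_, l, rfl, hl⟩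
  obtain ⟨l, hl, hw⟩ := Nat.find_spec h
  exact ⟨l, hw, fun l' hl' ↦ hl ▸ Nat.find_min' h ⟨l', rfl, hl'⟩⟩

/-- A reduced decomposition of `w`. -/
noncomputable def redWord {n : ℕ} (w : Equiv.Perm (Fin n)) : List (Fin (n - 1)) :=
  (exists_isReducedWord w).choose

/-- `w` is 321-avoiding (fully commutative): it has no reduced decomposition of the form
`⋯ s_i s_j s_i ⋯` with `|i - j| = 1`. -/
def Is321Avoiding {n : ℕ} (w : Equiv.Perm (Fin n)) : Prop :=
  ¬ ∃ (l₁ l₂ : List (Fin (n - 1))) (i j : Fin (n - 1)),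
    Adjacent i j ∧ IsReducedWord (l₁ ++ [i, j, i] ++ l₂) w

/-- The 321-avoiding permutations in `S_n`. -/
abbrev Avoiding321 (n : ℕ) : Type := {w : Equiv.Perm (Fin n) // Is321Avoiding w}

/-! ## The Temperley–Lieb algebra -/

/-- The defining relations of the Temperley–Lieb algebra with loop parameter `ξ`. -/
inductive TLRel (k : Type*) [CommRing k] (ξ : k) (n : ℕ) :
    FreeAlgebra k (Fin (n - 1)) → FreeAlgebra k (Fin (n - 1)) → Prop
  | sq (i : Fin (n - 1)) :
      TLRel k ξ n (FreeAlgebra.ι k i * FreeAlgebra.ι k i) (ξ • FreeAlgebra.ι k i)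
  | braid (i j : Fin (n - 1)) (h : Adjacent i j) :
      TLRel k ξ n (FreeAlgebra.ι k i * FreeAlgebra.ι k j * FreeAlgebra.ι k i)
        (FreeAlgebra.ι k i)
  | comm (i j : Fin (n - 1)) (h : Distant i j) :
      TLRel k ξ n (FreeAlgebra.ι k i * FreeAlgebra.ι k j)
        (FreeAlgebra.ι k j * FreeAlgebra.ι k i)

/-- The Temperley–Lieb algebra over `k` with loop parameter `ξ`, by generators and relations. -/
abbrev TL (k : Type*) [CommRing k] (ξ : k) (n : ℕ) : Type _ := RingQuot (TLRel k ξ n)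

/-- The algebra `TL_n(2)` over `ℂ`. -/
abbrev TL2 (n : ℕ) : Type := TL ℂ 2 n

/-- The generator `t_i` of `TL_n(2)`. -/
noncomputable def gen {n : ℕ} (i : Fin (n - 1)) : TL2 n :=
  RingQuot.mkAlgHom ℂ (TLRel ℂ 2 n) (FreeAlgebra.ι ℂ i)

/-- The element `t_w = t_{i₁} ⋯ t_{i_l}`, for a reduced decomposition `w = s_{i₁} ⋯ s_{i_l}`,
`w` being 321-avoiding. -/
noncomputable def tElem {n : ℕ} (w : Avoiding321 n) : TL2 n :=
  ((redWord w.1).map gen).prod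

/-- `θ(T_v) = (t_{i₁} - 1) ⋯ (t_{i_l} - 1)`, for a reduced decomposition
`v = s_{i₁} ⋯ s_{i_l}`. -/
noncomputable def theta {n : ℕ} (v : Equiv.Perm (Fin n)) : TL2 n :=
  ((redWord v).map fun i ↦ gen i - 1).prod

/-- The family `(t_w)`, `w` 321-avoiding, is a basis of `TL_n(2)`. -/
def IsTLBasis (n : ℕ) : Prop :=
  LinearIndependent ℂ (tElem : Avoiding321 n → TL2 n) ∧
    ⊤ ≤ Submodule.span ℂ (Set.range (tElem : Avoiding321 n → TL2 n))

open Classical in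
/-- `f_w(v)`: the coefficient of `t_w` in the expansion of `θ(T_v)` in the basis `(t_w)`. -/
noncomputable def tlCoeff {n : ℕ} (w : Avoiding321 n) (v : Equiv.Perm (Fin n)) : ℂ :=
  if h : IsTLBasis n then (Module.Basis.mk h.1 h.2).repr (theta v) w else 0

/-- The Temperley–Lieb immanant `Imm_w(X) = ∑_v f_w(v) x_{1,v(1)} ⋯ x_{n,v(n)}`. -/
noncomputable def tlImm {n : ℕ} {R : Type*} [CommRing R] [Algebra ℂ R]
    (X : Matrix (Fin n) (Fin n) R) (w : Avoiding321 n) : R :=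
  ∑ v : Equiv.Perm (Fin n), tlCoeff w v • ∏ i : Fin n, X i (v i)

/-! ## Temperley–Lieb diagrams

The vertices `1, …, 2n` of a diagram are `Fin (2 * n)`, shifted down by one. The vertices
`1, …, n` are on the left, from one end to the other, and `2n + 1 - i` is on the right,
opposite to `i`. -/

/-- The vertex `i`, on the left, for `i ∈ [n]`. -/
def leftVertex {n : ℕ} (i : Fin n) : Fin (2 * n) := ⟨i.1, by omega⟩

/-- The vertex `2n + 1 - i`, on the right, for `i ∈ [n]`. -/
def rightVertex {n : ℕ} (i : Fin n) : Fin (2 * n) := (leftVertex i).rev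

/-- The effect on a matching of attaching the diagram of `t_i` on the left. A matching is given
by the map `m` that sends each vertex to its partner. In the new matching `i` and `i + 1` are
partners, the former partners of `i` and `i + 1` (if these were not partners of each other,
which gives an internal loop) become partners, and all other edges are kept. -/
def attach {n : ℕ} (i : Fin (n - 1)) (m : Fin (2 * n) → Fin (2 * n)) (a : Fin (2 * n)) :
    Fin (2 * n) :=
  if a = leftVertex (lo i) then leftVertex (hi i)
  else if a = leftVertex (hi i) then leftVertex (lo i)
  else if m a = leftVertex (lo i) then m (leftVertex (hi i))
  else if m a = leftVertex (hi i) then m (leftVertex (lo i))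
  else m a

/-- The matching of the vertices by the strands of the Temperley–Lieb diagram of the product
`t_{i₁} ⋯ t_{i_l}`: each vertex is sent to the other end of its strand. In the diagram of the
empty product the strands join `i` and `2n + 1 - i`. -/
def matching {n : ℕ} : List (Fin (n - 1)) → Fin (2 * n) → Fin (2 * n)
  | [] => Fin.rev
  | i :: l => attach i (matching l)

/-- Each strand has one end in `S` and the other end in the complement of `S`. -/
def IsCompatible {n : ℕ} (S : Finset (Fin (2 * n))) (w : Avoiding321 n) : Prop :=
  ∀ a : Fin (2 * n), a ∈ S ↔ matching (redWord w.1) a ∉ S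

/-- `Θ(S)`: the set of all 321-avoiding `w` such that `t_w` is `S`-compatible. -/
noncomputable def Theta {n : ℕ} (S : Finset (Fin (2 * n))) : Finset (Avoiding321 n) :=
  (Set.toFinite {w | IsCompatible S w}).toFinset

/-- The set `J ∪ (Ī)^∧ ⊆ [2n]`, where `Ī = [n] \ I` and `K^∧ = {2n + 1 - i | i ∈ K}`. -/
def colourSet {n : ℕ} (I J : Finset (Fin n)) : Finset (Fin (2 * n)) :=
  J.image leftVertex ∪ Iᶜ.image rightVertex

/-! ## Minors -/

/-- The minor `Δ_{I,J}(X)` with row set `I` and column set `J`, both in increasing order. -/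
def minor {n : ℕ} {R : Type*} [CommRing R] (X : Matrix (Fin n) (Fin n) R)
    (I J : Finset (Fin n)) (h : I.card = J.card) : R :=
  (X.submatrix (I.orderEmbOfFin rfl) (J.orderEmbOfFin h.symm)).det

theorem card_compl_eq {n : ℕ} {I J : Finset (Fin n)} (h : I.card = J.card) :
    Iᶜ.card = Jᶜ.card := by
  rw [Finset.card_compl, Finset.card_compl, h]

end TLImm

/-! `TL_n(2)` acts on functions of two-colourings of `[n]` (the tensor power of a two-dimensional
space): `t_i` kills the value where `i`, `i + 1` have equal colours and otherwise adds the values at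
the colouring and at its swap. Hence `t_i - 1` is a signed permutation: it swaps different colours
and multiplies by `-1` on equal ones. For each pair `I`, `J`, the matrix coefficient `colourCoeff`
between the two colourings is a linear functional on `TL_n(2)`, and the theorem follows by computing
it in two ways.

On `theta v` it is zero unless `v` maps `I` to `J`; then it is the sign of `v` read through the
increasing enumerations of `I`, `J` and their complements. This is the coefficient of `∏ X i (v i)`
in the product of complementary minors (`colourCoeff_theta`, `minor_mul_minor_compl`). On `t_w` it
is `1` or `0` according to compatibility of the diagram (`colourCoeff_tElem`). Applying it to the
expansion of `theta v` gives `sum_tlCoeff`.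

The same functionals prove the basis claim. Spanning comes from rewriting a braid as shorter words.
For independence, a 321-avoiding `w` increases on some `I` and on its complement, so it is the
unique shortest permutation mapping `I` to `w(I)`; the coefficient at `I`, `w(I)` then isolates
`t_w` among the `t_u` with `u` no longer than `w`. -/

namespace TLImm

/-! ### Coxeter presentation of the symmetric group. -/

section Presentation

variable {M : Type*} [Monoid M]

/-- The relations of the Coxeter presentation of type `A_N`, for `g 0, …, g (N - 1)`. -/
structure CoxeterRel (g : ℕ → M) (N : ℕ) : Prop where
  sq : ∀ i, i < N → g i * g i = 1
  braid : ∀ i, i + 1 < N → g i * g (i + 1) * g i = g (i + 1) * g i * g (i + 1)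
  comm : ∀ i j, i + 2 ≤ j → j < N → g i * g j = g j * g i

/-- The product `g (k + d - 1) ⋯ g (k + 1) g k`. -/
def descProd (g : ℕ → M) : ℕ → ℕ → M
  | _, 0 => 1
  | k, d + 1 => descProd g (k + 1) d * g k

variable {g : ℕ → M} {N : ℕ}

theorem CoxeterRel.descProd_comm (h : CoxeterRel g N) (j d : ℕ) :
    ∀ k, j + 2 ≤ k → k + d ≤ N → descProd g k d * g j = g j * descProd g k d := by
  induction d with
  | zero => intro k _ _; simp [descProd]
  | succ d ih =>
    intro k hj hN
    rw [descProd, mul_assoc, ← h.comm j k hj (by omega), ← mul_assoc,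
      ih (k + 1) (by omega) (by omega), mul_assoc]

/-- A descending product behaves like a cycle, whose conjugation shifts inner generators by one. The
braid relation is needed only where the product reaches `g (j + 1) * g j`; all other factors commute
past. -/
theorem CoxeterRel.descProd_mul (h : CoxeterRel g N) (j d : ℕ) :
    ∀ k, k ≤ j → j + 1 < k + d → k + d ≤ N →
      descProd g k d * g (j + 1) = g j * descProd g k d := by
  induction d with
  | zero => intro k _ _; omega
  | succ d ih =>
    intro k hk hj hN
    rcases hk.eq_or_lt with rfl | hk
    · obtain ⟨e, rfl⟩ : ∃ e, d = e + 1 := ⟨d - 1, by omega⟩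
      simp only [descProd]
      rw [mul_assoc, mul_assoc, ← mul_assoc (g (k + 1)), ← h.braid k (by omega), ← mul_assoc,
        ← mul_assoc, h.descProd_comm k e (k + 1 + 1) (by omega) (by omega)]
      simp only [mul_assoc]
    · rw [descProd, mul_assoc, h.comm k (j + 1) (by omega) (by omega), ← mul_assoc,
        ih (k + 1) (by omega) (by omega) (by omega), mul_assoc]

/-- This is the coset decomposition of a symmetric group over the next smaller one. A new last
letter `j` commutes past the descending product if `j + 1 < k`, lengthens it if `j + 1 = k`, cancels
its last factor if `j = k`, and passes through as `j - 1` if `j > k`. -/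
theorem CoxeterRel.exists_normalForm (h : CoxeterRel g N) {m : ℕ} (hm : m + 1 ≤ N)
    (l : List ℕ) (hl : ∀ i ∈ l, i < m + 1) :
    ∃ (k d : ℕ) (l' : List ℕ), k + d = m + 1 ∧ (∀ i ∈ l', i < m) ∧
      (l.map g).prod = (l'.map g).prod * descProd g k d := by
  induction l using List.reverseRecOn with
  | nil => exact ⟨m + 1, 0, [], rfl, by simp, by simp [descProd]⟩
  | append_singleton l j ih =>
    obtain ⟨k, d, l', hkd, hl', e⟩ := ih fun i hi ↦ hl i (by simp [hi])
    have hj : j < m + 1 := hl j (by simp)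
    rw [List.map_append, List.prod_append, e, List.map_singleton, List.prod_singleton]
    have extend (i : ℕ) (hi : i < m) (e' : descProd g k d * g j = g i * descProd g k d) :
        ∃ (k' d' : ℕ) (l'' : List ℕ), k' + d' = m + 1 ∧ (∀ i ∈ l'', i < m) ∧
          (l'.map g).prod * descProd g k d * g j = (l''.map g).prod * descProd g k' d' :=
      ⟨k, d, l' ++ [i], hkd, by
        intro x hx
        rcases List.mem_append.1 hx with hx | hx
        · exact hl' x hx
        · rw [List.mem_singleton.1 hx]; exact hi, by simp [mul_assoc, e']⟩
    rcases lt_trichotomy j k with hjk | rfl | hjk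
    · rcases (Nat.succ_le_of_lt hjk).eq_or_lt with hk | hk
      · subst hk
        exact ⟨j, d + 1, l', by omega, hl', by rw [descProd, mul_assoc]⟩
      · exact extend j (by omega) (h.descProd_comm j d k (by omega) (by omega))
    · obtain ⟨d, rfl⟩ : ∃ e, d = e + 1 := ⟨d - 1, by omega⟩
      exact ⟨j + 1, d, l', by omega, hl', by
        rw [descProd, mul_assoc, mul_assoc, h.sq j (by omega), mul_one]⟩
    · obtain ⟨i, rfl⟩ : ∃ i, j = i + 1 := ⟨j - 1, by omega⟩
      exact extend i (by omega) (h.descProd_mul i d k (by omega) (by omega) (by omega))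

/-- The adjacent transpositions of `ℕ`. -/
def natSwap (i : ℕ) : Equiv.Perm ℕ := Equiv.swap i (i + 1)

theorem coxeterRel_natSwap (N : ℕ) : CoxeterRel natSwap N where
  sq i _ := Equiv.swap_mul_self _ _
  braid i _ := by
    ext x
    simp only [natSwap, Equiv.Perm.mul_apply, Equiv.swap_apply_def]
    grind
  comm i j _ _ := by
    ext x
    simp only [natSwap, Equiv.Perm.mul_apply, Equiv.swap_apply_def]
    grind

theorem natSwap_word_apply_of_lt {x : ℕ} (l : List ℕ) (hl : ∀ i ∈ l, i + 1 < x) :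
    (l.map natSwap).prod x = x := by
  induction l with
  | nil => rfl
  | cons i l ih =>
    have hi := hl i (by simp)
    rw [List.map_cons, List.prod_cons, Equiv.Perm.mul_apply, ih fun j hj ↦ hl j (by simp [hj])]
    exact Equiv.swap_apply_of_ne_of_ne (by omega) (by omega)

theorem descProd_natSwap_apply (d : ℕ) : ∀ k, descProd natSwap k d k = k + d := by
  induction d with
  | zero => intro k; rfl
  | succ d ih =>
    intro k
    rw [descProd, Equiv.Perm.mul_apply, natSwap, Equiv.swap_apply_left, ih]
    omega

/-- Working in the product monoid makes one normal form, with the same `k` and `d`, serve both the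
family `g` and the permutations. -/
theorem CoxeterRel.prod_natSwap (h : CoxeterRel g N) :
    CoxeterRel (fun i ↦ (g i, natSwap i)) N where
  sq i hi := Prod.ext (h.sq i hi) ((coxeterRel_natSwap N).sq i hi)
  braid i hi := Prod.ext (h.braid i hi) ((coxeterRel_natSwap N).braid i hi)
  comm i j hij hj := Prod.ext (h.comm i j hij hj) ((coxeterRel_natSwap N).comm i j hij hj)

theorem prod_map_pair {P : Type*} [Monoid P] (g : ℕ → M) (g' : ℕ → P) (l : List ℕ) :
    (l.map fun i ↦ (g i, g' i)).prod = ((l.map g).prod, (l.map g').prod) := by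
  induction l with
  | nil => rfl
  | cons i l ih => simp [ih]

theorem descProd_pair {P : Type*} [Monoid P] (g : ℕ → M) (g' : ℕ → P) (d : ℕ) :
    ∀ k, descProd (fun i ↦ (g i, g' i)) k d = (descProd g k d, descProd g' k d) := by
  induction d with
  | zero => intro k; rfl
  | succ d ih => intro k; simp [descProd, ih]

/-- Coxeter presentation of the symmetric group: a word in the adjacent transpositions with
trivial product is trivial for every family satisfying the Coxeter relations. -/
theorem CoxeterRel.prod_eq_one (h : CoxeterRel g N) (m : ℕ) :
    ∀ l : List ℕ, m ≤ N → (∀ i ∈ l, i < m) → (l.map natSwap).prod = 1 →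
      (l.map g).prod = 1 := by
  induction m with
  | zero =>
    intro l _ hl _
    rw [List.eq_nil_iff_forall_not_mem.2 fun i hi ↦ absurd (hl i hi) (Nat.not_lt_zero i)]
    rfl
  | succ m ih =>
    intro l hm hl h1
    obtain ⟨k, d, l', hkd, hl', e⟩ := h.prod_natSwap.exists_normalForm hm l hl
    rw [prod_map_pair, prod_map_pair, descProd_pair, Prod.mk_mul_mk, Prod.mk.injEq, h1] at e
    -- The descending product sends `k` to `m + 1`, which `l'` fixes. Triviality of the product thus
    -- forces `k = m + 1`, so `d = 0`.
    have hk := congrArg (fun p : Equiv.Perm ℕ ↦ p k) e.2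
    simp only [Equiv.Perm.one_apply, Equiv.Perm.mul_apply, descProd_natSwap_apply, hkd] at hk
    rw [natSwap_word_apply_of_lt l' fun i hi ↦ Nat.succ_lt_succ (hl' i hi)] at hk
    obtain rfl : d = 0 := by omega
    simp only [descProd, mul_one] at e
    rw [e.1, ih l' (by omega) hl' e.2.symm]

/-- Supplies inverses, since `M` is only a monoid. -/
theorem CoxeterRel.prod_reverse_mul (h : CoxeterRel g N) (l : List ℕ) (hl : ∀ i ∈ l, i < N) :
    (l.reverse.map g).prod * (l.map g).prod = 1 := by
  induction l with
  | nil => simp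
  | cons i l ih =>
    rw [List.reverse_cons, List.map_append, List.prod_append, List.map_singleton,
      List.prod_singleton, List.map_cons, List.prod_cons, mul_assoc, ← mul_assoc (g i),
      h.sq i (hl i (by simp)), one_mul, ih fun j hj ↦ hl j (by simp [hj])]

theorem CoxeterRel.prod_eq (h : CoxeterRel g N) {l l' : List ℕ} (hl : ∀ i ∈ l, i < N)
    (hl' : ∀ i ∈ l', i < N) (e : (l.map natSwap).prod = (l'.map natSwap).prod) :
    (l.map g).prod = (l'.map g).prod := by
  have hs := (coxeterRel_natSwap N).prod_reverse_mul l' hl'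
  have h1 := h.prod_eq_one N (l'.reverse ++ l) le_rfl (by
    intro i hi
    rcases List.mem_append.1 hi with hi | hi
    · exact hl' i (List.mem_reverse.1 hi)
    · exact hl i hi) (by rw [List.map_append, List.prod_append, e, hs])
  rw [List.map_append, List.prod_append] at h1
  have h2 := h.prod_reverse_mul l'.reverse fun i hi ↦ hl' i (List.mem_reverse.1 hi)
  rw [List.reverse_reverse] at h2
  calc (l.map g).prod = (l'.map g).prod * (l'.reverse.map g).prod * (l.map g).prod := by
        rw [h2, one_mul]
    _ = (l'.map g).prod := by rw [mul_assoc, h1, mul_one]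

end Presentation

variable {n : ℕ}

/-! ## The homomorphism from the symmetric group -/

section Generators

theorem gen_sq (i : Fin (n - 1)) : gen i * gen i = (2 : ℂ) • gen i := by
  simp only [gen]
  rw [← map_mul, ← map_smul]
  exact RingQuot.mkAlgHom_rel ℂ (.sq i)

theorem gen_braid {i j : Fin (n - 1)} (h : Adjacent i j) : gen i * gen j * gen i = gen i := by
  simp only [gen]
  rw [← map_mul, ← map_mul]
  exact RingQuot.mkAlgHom_rel ℂ (.braid i j h)

theorem gen_comm {i j : Fin (n - 1)} (h : Distant i j) : gen i * gen j = gen j * gen i := by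
  simp only [gen]
  rw [← map_mul, ← map_mul]
  exact RingQuot.mkAlgHom_rel ℂ (.comm i j h)

/-- The image `t_i - 1` of the adjacent transposition `s_i` in `TL_n(2)`. -/
noncomputable def swapGen (i : Fin (n - 1)) : TL2 n := gen i - 1

theorem swapGen_sq (i : Fin (n - 1)) : swapGen i * swapGen i = 1 := by
  have h := gen_sq i
  rw [two_smul] at h
  have : swapGen i * swapGen i = gen i * gen i - (gen i + gen i) + 1 := by
    simp only [swapGen, sub_mul, mul_sub, one_mul, mul_one]; abel
  rw [this, h, sub_self, zero_add]

/-- The images of the six elements of the `S_3` generated by `s_i`, `s_j` sum to zero. The right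
side is symmetric in `i` and `j`, which gives the braid relation, and involves only shorter words,
which gives spanning. -/
theorem swapGen_triple {i j : Fin (n - 1)} (h : Adjacent i j) :
    swapGen i * swapGen j * swapGen i =
      -(1 + swapGen i + swapGen j + swapGen i * swapGen j + swapGen j * swapGen i) := by
  have h2 := gen_sq i
  rw [two_smul] at h2
  have : swapGen i * swapGen j * swapGen i = gen i * gen j * gen i - gen i * gen j
      - gen j * gen i - gen i * gen i + gen j + gen i + gen i - 1 := by
    simp only [swapGen, sub_mul, mul_sub, one_mul, mul_one, mul_assoc]; abel
  rw [this, h2, gen_braid h]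
  simp only [swapGen, sub_mul, mul_sub, one_mul, mul_one]; abel

theorem Adjacent.symm {i j : Fin (n - 1)} (h : Adjacent i j) : Adjacent j i := Or.symm h

theorem swapGen_braid {i j : Fin (n - 1)} (h : Adjacent i j) :
    swapGen i * swapGen j * swapGen i = swapGen j * swapGen i * swapGen j := by
  rw [swapGen_triple h, swapGen_triple h.symm]
  abel

theorem swapGen_comm {i j : Fin (n - 1)} (h : Distant i j) :
    swapGen i * swapGen j = swapGen j * swapGen i := by
  have : swapGen i * swapGen j = gen i * gen j - gen i - gen j + 1 := by
    simp only [swapGen, sub_mul, mul_sub, one_mul, mul_one]; abel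
  rw [this, gen_comm h]
  simp only [swapGen, sub_mul, mul_sub, one_mul, mul_one]; abel

/-- The family `swapGen`, extended to all natural numbers. -/
noncomputable def natSwapGen (n i : ℕ) : TL2 n := if h : i < n - 1 then swapGen ⟨i, h⟩ else 1

theorem coxeterRel_natSwapGen : CoxeterRel (natSwapGen n) (n - 1) where
  sq i hi := by simp only [natSwapGen, hi, dif_pos, swapGen_sq]
  braid i hi := by
    have hi' : i < n - 1 := by omega
    simp only [natSwapGen, hi, hi', dif_pos]
    exact swapGen_braid (Or.inl rfl)
  comm i j hij hj := by
    have hi : i < n - 1 := by omega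
    simp only [natSwapGen, hi, hj, dif_pos]
    exact swapGen_comm (Or.inl hij)

/-- The product in `S_n` of a word in the adjacent transpositions. -/
abbrev wordProd (l : List (Fin (n - 1))) : Equiv.Perm (Fin n) := (l.map adjSwap).prod

theorem natSwap_apply_coe (i : Fin (n - 1)) (x : Fin n) : natSwap i x = (adjSwap i x : Fin n) := by
  simp only [natSwap, adjSwap, Equiv.swap_apply_def, lo, hi, Fin.ext_iff]
  split_ifs <;> rfl

theorem natSwap_word_apply_coe (l : List (Fin (n - 1))) (x : Fin n) :
    ((l.map Fin.val).map natSwap).prod x = (wordProd l x : Fin n) := by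
  induction l with
  | nil => rfl
  | cons i l ih =>
    simp only [wordProd, List.map_cons, List.prod_cons, Equiv.Perm.mul_apply] at ih ⊢
    rw [ih, natSwap_apply_coe]

theorem natSwap_word_eq {l l' : List (Fin (n - 1))} (h : wordProd l = wordProd l') :
    ((l.map Fin.val).map natSwap).prod = ((l'.map Fin.val).map natSwap).prod := by
  ext x
  by_cases hx : x < n
  · have := natSwap_word_apply_coe l ⟨x, hx⟩
    rw [h, ← natSwap_word_apply_coe l'] at this
    exact this
  · have hlt (l : List (Fin (n - 1))) : ∀ i ∈ l.map Fin.val, i + 1 < x := by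
      intro i hi
      obtain ⟨j, -, rfl⟩ := List.mem_map.1 hi
      omega
    rw [natSwap_word_apply_of_lt _ (hlt l), natSwap_word_apply_of_lt _ (hlt l')]

theorem natSwapGen_word (l : List (Fin (n - 1))) :
    ((l.map Fin.val).map (natSwapGen n)).prod = (l.map swapGen).prod := by
  rw [List.map_map]
  congr 2
  funext i
  simp [natSwapGen]

/-- The product of the `t_i - 1` along a word depends only on the permutation. -/
theorem swapGen_word_eq {l l' : List (Fin (n - 1))} (h : wordProd l = wordProd l') :
    (l.map swapGen).prod = (l'.map swapGen).prod := by
  have hlt (l : List (Fin (n - 1))) : ∀ i ∈ l.map Fin.val, i < n - 1 := by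
    intro i hi
    obtain ⟨j, -, rfl⟩ := List.mem_map.1 hi
    exact j.2
  rw [← natSwapGen_word, ← natSwapGen_word]
  exact coxeterRel_natSwapGen.prod_eq (hlt l) (hlt l') (natSwap_word_eq h)

end Generators

/-! ## Reduced words and pattern avoidance -/

section Words

theorem isReducedWord_redWord (w : Equiv.Perm (Fin n)) : IsReducedWord (redWord w) w :=
  (exists_isReducedWord w).choose_spec

theorem wordProd_redWord (w : Equiv.Perm (Fin n)) : wordProd (redWord w) = w :=
  (isReducedWord_redWord w).1

theorem redWord_length_le {w : Equiv.Perm (Fin n)} {l : List (Fin (n - 1))}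
    (h : wordProd l = w) : (redWord w).length ≤ l.length :=
  (isReducedWord_redWord w).2 l h

theorem wordProd_cons (i : Fin (n - 1)) (l : List (Fin (n - 1))) :
    wordProd (i :: l) = adjSwap i * wordProd l := by simp [wordProd]

theorem wordProd_append (l l' : List (Fin (n - 1))) :
    wordProd (l ++ l') = wordProd l * wordProd l' := by simp [wordProd]

theorem lo_lt_hi (i : Fin (n - 1)) : lo i < hi i := Nat.lt_succ_self _

theorem lo_ne_hi (i : Fin (n - 1)) : lo i ≠ hi i := (lo_lt_hi i).ne

/-- `s_i` reverses the order of no pair but `i < i + 1`. -/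
theorem adjSwap_lt_or (i : Fin (n - 1)) {a b : Fin n} (h : a < b) :
    adjSwap i a < adjSwap i b ∨ a = lo i ∧ b = hi i := by
  have ha := natSwap_apply_coe i a
  have hb := natSwap_apply_coe i b
  simp only [natSwap, Equiv.swap_apply_def] at ha hb
  simp only [Fin.lt_def, lo, hi, Fin.ext_iff] at h ⊢
  split_ifs at ha hb <;> omega

/-- The strong exchange property. -/
theorem exists_word_mul_swap (l : List (Fin (n - 1))) {a b : Fin n} (hab : a < b)
    (h : wordProd l b < wordProd l a) :
    ∃ l' : List (Fin (n - 1)), l'.length < l.length ∧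
      wordProd l' = wordProd l * Equiv.swap a b := by
  induction l with
  | nil => exact absurd h hab.asymm
  | cons i l ih =>
    rw [wordProd_cons] at h ⊢
    rcases lt_or_gt_of_ne ((wordProd l).injective.ne hab.ne) with h' | h'
    · rcases adjSwap_lt_or i h' with h'' | ⟨ha, hb⟩
      · exact absurd h h''.asymm
      -- The letter `i` itself creates the inversion of `a` and `b`, so deleting it has the effect
      -- of multiplying by the transposition.
      · refine ⟨l, Nat.lt_succ_self _, ?_⟩
        rw [mul_assoc, Equiv.mul_swap_eq_swap_mul, ha, hb, ← mul_assoc, adjSwap,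
          Equiv.swap_mul_self, one_mul]
    · obtain ⟨l', hl, e⟩ := ih h'
      exact ⟨i :: l', Nat.succ_lt_succ hl, by rw [wordProd_cons, e, mul_assoc]⟩

/-- At a descent, exchange turns any word for `w` into a strictly shorter word for `w * adjSwap i`,
so one extra letter is optimal. -/
theorem IsReducedWord.append_singleton {w : Equiv.Perm (Fin n)} {l : List (Fin (n - 1))}
    {i : Fin (n - 1)} (hl : IsReducedWord l (w * adjSwap i)) (h : w (hi i) < w (lo i)) :
    IsReducedWord (l ++ [i]) w := by
  refine ⟨?_, fun l' hl' ↦ ?_⟩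
  · change wordProd (l ++ [i]) = w
    rw [wordProd_append, show wordProd l = _ from hl.1, wordProd, List.map_singleton,
      List.prod_singleton, mul_assoc, adjSwap, Equiv.swap_mul_self, mul_one]
  · change wordProd l' = w at hl'
    obtain ⟨l'', hlen, e⟩ := exists_word_mul_swap l' (lo_lt_hi i) (by rwa [hl'])
    have := hl.2 l'' (by rw [← hl']; exact e)
    rw [List.length_append, List.length_singleton]
    omega

theorem length_redWord_mul_adjSwap_lt {w : Equiv.Perm (Fin n)} {i : Fin (n - 1)}
    (h : w (hi i) < w (lo i)) : (redWord (w * adjSwap i)).length < (redWord w).length := by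
  obtain ⟨l, hl, e⟩ := exists_word_mul_swap (redWord w) (lo_lt_hi i) (by rwa [wordProd_redWord])
  exact (redWord_length_le (by rw [e, wordProd_redWord]; rfl)).trans_lt hl

/-- A reduced word of the form `⋯ s_i s_j s_i ⋯` with `|i - j| = 1`. -/
def HasBraid (w : Equiv.Perm (Fin n)) : Prop :=
  ∃ (l₁ l₂ : List (Fin (n - 1))) (i j : Fin (n - 1)),
    Adjacent i j ∧ IsReducedWord (l₁ ++ [i, j, i] ++ l₂) w

theorem HasBraid.of_mul {w : Equiv.Perm (Fin n)} {i : Fin (n - 1)}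
    (hw : HasBraid (w * adjSwap i)) (h : w (hi i) < w (lo i)) : HasBraid w := by
  obtain ⟨l₁, l₂, j, k, hjk, hl⟩ := hw
  exact ⟨l₁, l₂ ++ [i], j, k, hjk, by simpa using hl.append_singleton h⟩

theorem adjSwap_apply_of_ne (i : Fin (n - 1)) {x : Fin n} (h₁ : x.1 ≠ i.1) (h₂ : x.1 ≠ i.1 + 1) :
    adjSwap i x = x :=
  Equiv.swap_apply_of_ne_of_ne (fun h ↦ h₁ (congrArg Fin.val h)) fun h ↦ h₂ (congrArg Fin.val h)

theorem adjSwap_lo (i : Fin (n - 1)) : adjSwap i (lo i) = hi i := Equiv.swap_apply_left _ _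

theorem adjSwap_hi (i : Fin (n - 1)) : adjSwap i (hi i) = lo i := Equiv.swap_apply_right _ _

/-- Three decreasing consecutive values are sorted by `s_i s_j s_i`. Undoing this passes through
three descents, so appending `i, j, i` to a reduced word stays reduced. -/
theorem hasBraid_of_consecutive {w : Equiv.Perm (Fin n)} {i j : Fin (n - 1)} (hij : i.1 + 1 = j.1)
    (h₁ : w (hi i) < w (lo i)) (h₂ : w (hi j) < w (hi i)) : HasBraid w := by
  have e : lo j = hi i := Fin.ext hij.symm
  have hlo : adjSwap j (lo i) = lo i :=
    adjSwap_apply_of_ne j (by simp only [lo]; omega) (by simp only [lo]; omega)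
  have hhi : adjSwap i (hi j) = hi j :=
    adjSwap_apply_of_ne i (by simp only [hi]; omega) (by simp only [hi]; omega)
  have r := (isReducedWord_redWord (w * adjSwap i * adjSwap j * adjSwap i)).append_singleton
    (by simp only [Equiv.Perm.mul_apply, adjSwap_lo, hlo, hhi, ← e]
        rw [e]; exact h₂)
  have r' := r.append_singleton
    (by simp only [Equiv.Perm.mul_apply, hhi, e, adjSwap_hi]; exact h₂.trans h₁)
  have r'' := r'.append_singleton h₁
  exact ⟨_, [], i, j, Or.inl hij, by simpa using r''⟩

/-- The outer positions of a 321 pattern are moved inwards until all three are consecutive. If the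
step from the outer position towards the middle is an ascent of `w`, the neighbour can replace it;
at a descent, `w` is replaced by the shorter `w * adjSwap i`, and `HasBraid.of_mul` returns to `w`.
Either way length plus width drops. -/
theorem hasBraid_of_pattern (N : ℕ) : ∀ (w : Equiv.Perm (Fin n)) (a b c : Fin n),
    (redWord w).length + (c.1 - a.1) ≤ N → a < b → b < c → w b < w a → w c < w b →
      HasBraid w := by
  induction N with
  | zero => intro w a b c hN hab hbc _ _; simp only [Fin.lt_def] at hab hbc; omega
  | succ N ih =>
    intro w a b c hN hab hbc hba hcb
    simp only [Fin.lt_def] at hab hbc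
    by_cases hab' : a.1 + 1 = b.1
    · by_cases hbc' : b.1 + 1 = c.1
      · have e₁ : hi ⟨a.1, by omega⟩ = b := Fin.ext hab'
        have e₂ : hi ⟨b.1, by omega⟩ = c := Fin.ext hbc'
        exact hasBraid_of_consecutive (i := ⟨a.1, by omega⟩) (j := ⟨b.1, by omega⟩) hab'
          (by rw [e₁]; exact hba) (by rw [e₁, e₂]; exact hcb)
      · obtain ⟨i, hic⟩ : ∃ i : Fin (n - 1), i.1 + 1 = c.1 := ⟨⟨c.1 - 1, by omega⟩, by simp; omega⟩
        have hc : hi i = c := Fin.ext hic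
        have hbi : b < lo i := by simp only [Fin.lt_def, lo]; omega
        rcases lt_or_gt_of_ne (w.injective.ne (lo_ne_hi i)) with h | h
        · exact ih w a b (lo i) (by simp only [lo]; omega) hab hbi hba (h.trans (hc ▸ hcb))
        · have hlen := length_redWord_mul_adjSwap_lt h
          have ha : adjSwap i a = a := adjSwap_apply_of_ne i (by omega) (by omega)
          have hb : adjSwap i b = b := by
            simp only [Fin.lt_def, lo] at hbi
            exact adjSwap_apply_of_ne i (by omega) (by omega)
          refine (ih (w * adjSwap i) a b (lo i) (by simp only [lo]; omega) hab hbi ?_ ?_).of_mul h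
          · simpa only [Equiv.Perm.mul_apply, ha, hb] using hba
          · simpa only [Equiv.Perm.mul_apply, adjSwap_lo, hb, hc] using hcb
    · obtain ⟨i, hia⟩ : ∃ i : Fin (n - 1), i.1 = a.1 := ⟨⟨a.1, by omega⟩, rfl⟩
      have ha : lo i = a := Fin.ext hia
      have hib : hi i < b := by simp only [Fin.lt_def, hi]; omega
      rcases lt_or_gt_of_ne (w.injective.ne (lo_ne_hi i)) with h | h
      · exact ih w (hi i) b c (by simp only [hi]; omega) hib hbc ((ha ▸ hba).trans h) hcb
      · have hlen := length_redWord_mul_adjSwap_lt h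
        simp only [Fin.lt_def, hi] at hib
        have hb : adjSwap i b = b := adjSwap_apply_of_ne i (by omega) (by omega)
        have hc : adjSwap i c = c := adjSwap_apply_of_ne i (by omega) (by omega)
        refine (ih (w * adjSwap i) (hi i) b c (by simp only [hi]; omega) hib hbc ?_ ?_).of_mul h
        · simpa only [Equiv.Perm.mul_apply, adjSwap_hi, hb, ha] using hba
        · simpa only [Equiv.Perm.mul_apply, hb, hc] using hcb

/-- A 321-avoiding permutation is increasing on some set and on its complement. -/
theorem Is321Avoiding.exists_strictMonoOn {w : Equiv.Perm (Fin n)} (hw : Is321Avoiding w) :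
    ∃ I : Finset (Fin n), StrictMonoOn w I ∧ StrictMonoOn w (Iᶜ : Finset (Fin n)) := by
  classical
  -- The set consists of the positions of left-to-right maxima. Any other position has a larger
  -- value before it, so a descent between two such positions would complete a 321 pattern.
  refine ⟨Finset.univ.filter fun i ↦ ∀ j < i, w j < w i, ?_, ?_⟩
  · intro a _ b hb hab
    exact (Finset.mem_filter.1 hb).2 a hab
  · intro a ha b hb hab
    simp only [Finset.coe_compl, Set.mem_compl_iff, Finset.mem_coe, Finset.mem_filter,
      Finset.mem_univ, true_and, not_forall, not_lt] at ha
    obtain ⟨c, hca, hac⟩ := ha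
    by_contra hba
    exact hw (hasBraid_of_pattern _ w c a b le_rfl hca hab
      (hac.lt_of_ne (w.injective.ne hca.ne')) ((not_lt.1 hba).lt_of_ne (w.injective.ne hab.ne')))

theorem eqOn_of_strictMonoOn_of_image_eq {u w : Equiv.Perm (Fin n)} {I : Finset (Fin n)}
    (hu : StrictMonoOn u I) (hw : StrictMonoOn w I) (h : I.image u = I.image w) :
    Set.EqOn u w I := by
  have := (StrictMono.range_inj (f := fun x : (I : Set (Fin n)) ↦ u x)
    (g := fun x : (I : Set (Fin n)) ↦ w x) (fun a b hab ↦ hu a.2 b.2 hab)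
    (fun a b hab ↦ hw a.2 b.2 hab)).1 (by
      rw [← Set.image_eq_range, ← Set.image_eq_range, ← Finset.coe_image, ← Finset.coe_image, h])
  exact fun x hx ↦ congrFun this ⟨x, hx⟩

theorem image_compl_perm (u : Equiv.Perm (Fin n)) (I : Finset (Fin n)) :
    Iᶜ.image u = (I.image u)ᶜ := by
  ext x
  obtain ⟨y, rfl⟩ := u.surjective x
  simp

/-- A permutation that is increasing on `I` and on its complement is the shortest one with the
given image of `I`. -/
theorem exists_word_of_image_eq {w : Equiv.Perm (Fin n)} {I : Finset (Fin n)}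
    (hI : StrictMonoOn w I) (hI' : StrictMonoOn w (Iᶜ : Finset (Fin n))) (N : ℕ) :
    ∀ l : List (Fin (n - 1)), l.length ≤ N → I.image (wordProd l) = I.image w →
      wordProd l = w ∨ ∃ l', l'.length < l.length ∧ wordProd l' = w := by
  induction N with
  | zero =>
    intro l hl h
    obtain rfl := List.length_eq_zero_iff.1 (Nat.le_zero.1 hl)
    left
    have e₁ := eqOn_of_strictMonoOn_of_image_eq (u := wordProd []) (fun a _ b _ hab ↦ hab) hI h
    have e₂ := eqOn_of_strictMonoOn_of_image_eq (u := wordProd []) (I := Iᶜ)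
      (fun a _ b _ hab ↦ hab) hI' (by rw [image_compl_perm, image_compl_perm, h])
    ext x
    by_cases hx : x ∈ I
    · rw [e₁ hx]
    · rw [e₂ (Finset.mem_coe.2 (Finset.mem_compl.2 hx))]
  | succ N ih =>
    intro l hl h
    -- An inversion inside `I` or inside its complement can be removed by a transposition preserving
    -- `I`; exchange makes the word shorter and keeps the image of `I`.
    have step {a b : Fin n} (hab : a < b) (hw : wordProd l b < wordProd l a)
        (him : I.image (Equiv.swap a b) = I) : ∃ l', l'.length < l.length ∧ wordProd l' = w := by
      obtain ⟨l', hl', e⟩ := exists_word_mul_swap l hab hw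
      rcases ih l' (by omega) (by
        rw [e, Equiv.Perm.coe_mul, ← Finset.image_image, him, h]) with e' | ⟨l'', hl'', e'⟩
      · exact ⟨l', hl', e'⟩
      · exact ⟨l'', hl''.trans hl', e'⟩
    by_cases h₁ : StrictMonoOn (wordProd l) I
    · by_cases h₂ : StrictMonoOn (wordProd l) (Iᶜ : Finset (Fin n))
      · left
        have e₁ := eqOn_of_strictMonoOn_of_image_eq h₁ hI h
        have e₂ := eqOn_of_strictMonoOn_of_image_eq h₂ hI'
          (by rw [image_compl_perm, image_compl_perm, h])
        ext x
        by_cases hx : x ∈ I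
        · rw [e₁ hx]
        · rw [e₂ (Finset.mem_coe.2 (Finset.mem_compl.2 hx))]
      · right
        simp only [StrictMonoOn, not_forall, not_lt] at h₂
        obtain ⟨a, ha, b, hb, hab, hw⟩ := h₂
        simp only [Finset.coe_compl, Set.mem_compl_iff, Finset.mem_coe] at ha hb
        refine step hab (hw.lt_of_ne ((wordProd l).injective.ne hab.ne')) ?_
        ext x
        simp only [Finset.mem_image, Equiv.swap_apply_def]
        grind
    · right
      simp only [StrictMonoOn, not_forall, not_lt] at h₁
      obtain ⟨a, ha, b, hb, hab, hw⟩ := h₁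
      simp only [Finset.mem_coe] at ha hb
      refine step hab (hw.lt_of_ne ((wordProd l).injective.ne hab.ne')) ?_
      ext x
      simp only [Finset.mem_image, Equiv.swap_apply_def]
      grind

end Words

/-! ## The elements `t_w` span -/

section Span

theorem gen_eq_swapGen_add_one (i : Fin (n - 1)) : gen i = swapGen i + 1 :=
  (sub_add_cancel _ _).symm

/-- The product of the `t_i` along a word is the product of the `t_i - 1` up to products along
shorter words. -/
theorem gen_word_sub_mem (l : List (Fin (n - 1))) :
    (l.map gen).prod - (l.map swapGen).prod ∈
      Submodule.span ℂ ((fun l' : List (Fin (n - 1)) ↦ (l'.map swapGen).prod) ''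
        {l' | l'.length < l.length}) := by
  induction l with
  | nil => simp
  | cons i l ih =>
    have e : ((i :: l).map gen).prod - ((i :: l).map swapGen).prod =
        swapGen i * ((l.map gen).prod - (l.map swapGen).prod) +
          ((l.map gen).prod - (l.map swapGen).prod) + (l.map swapGen).prod := by
      simp only [List.map_cons, List.prod_cons, gen_eq_swapGen_add_one i, add_mul, one_mul, mul_sub]
      abel
    rw [e]
    refine add_mem (add_mem ?_ ?_) (Submodule.subset_span ⟨l, Nat.lt_succ_self _, rfl⟩)
    · generalize (l.map gen).prod - (l.map swapGen).prod = z at ih ⊢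
      induction ih using Submodule.span_induction with
      | mem x hx =>
        obtain ⟨l', hl', rfl⟩ := hx
        exact Submodule.subset_span ⟨i :: l', Nat.succ_lt_succ hl', by simp⟩
      | zero => simp
      | add x y _ _ hx hy => rw [mul_add]; exact add_mem hx hy
      | smul a x _ hx => rw [mul_smul_comm]; exact Submodule.smul_mem _ a hx
    · exact Submodule.span_mono
        (Set.image_mono fun l' hl' ↦ (show l'.length < l.length from hl').trans
          (Nat.lt_succ_self _)) ih

theorem mul_neg_sum_mul {A : Type*} [Ring A] (p q a b c d : A) :
    p * -(1 + a + b + c + d) * q = -(p * q + p * a * q + p * b * q + p * c * q + p * d * q) := by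
  simp only [mul_add, add_mul, mul_neg, neg_mul, mul_one]

/-- Modulo shorter words, a word for a 321-avoiding permutation may be replaced by `t_w`. Otherwise
a reduced word contains a braid, and `swapGen_triple` expands it into shorter words. -/
theorem swapGen_word_mem_span (N : ℕ) : ∀ l : List (Fin (n - 1)), l.length = N →
    (l.map swapGen).prod ∈ Submodule.span ℂ (Set.range (tElem : Avoiding321 n → TL2 n)) := by
  induction N using Nat.strong_induction_on with
  | _ N ih =>
    intro l hN
    have hle := redWord_length_le (rfl : wordProd l = wordProd l)
    have hlt (l' : List (Fin (n - 1))) (hl' : l'.length < N) := ih _ hl' l' rfl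
    by_cases hw : Is321Avoiding (wordProd l)
    · rw [← swapGen_word_eq (wordProd_redWord (wordProd l)),
        ← sub_sub_cancel ((redWord (wordProd l)).map gen).prod
          ((redWord (wordProd l)).map swapGen).prod]
      refine sub_mem (Submodule.subset_span ⟨⟨_, hw⟩, rfl⟩) ?_
      refine Submodule.span_le.2 ?_ (gen_word_sub_mem (redWord (wordProd l)))
      rintro _ ⟨l', hl', rfl⟩
      exact hlt l' (hN ▸ lt_of_lt_of_le hl' hle)
    · obtain ⟨l₁, l₂, i, j, hij, hl⟩ := not_not.1 hw
      have hlen := hl.2 l rfl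
      simp only [List.length_append, List.length_cons, List.length_nil] at hlen
      rw [← swapGen_word_eq (show wordProd _ = wordProd l from hl.1)]
      have e : ((l₁ ++ [i, j, i] ++ l₂).map swapGen).prod =
          -(((l₁ ++ l₂).map swapGen).prod + ((l₁ ++ [i] ++ l₂).map swapGen).prod +
            ((l₁ ++ [j] ++ l₂).map swapGen).prod + ((l₁ ++ [i, j] ++ l₂).map swapGen).prod +
            ((l₁ ++ [j, i] ++ l₂).map swapGen).prod) := by
        have h3 := swapGen_triple hij
        simp only [List.map_append, List.prod_append, List.map_cons, List.map_nil, List.prod_cons,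
          List.prod_nil, mul_one]
        rw [← mul_assoc (swapGen i), h3]
        exact mul_neg_sum_mul _ _ _ _ _ _
      rw [e]
      refine neg_mem (add_mem (add_mem (add_mem (add_mem ?_ ?_) ?_) ?_) ?_) <;>
        exact hlt _ (by
          simp only [List.length_append, List.length_cons, List.length_nil]; omega)

theorem span_swapGen_word :
    Submodule.span ℂ (Set.range fun l : List (Fin (n - 1)) ↦ (l.map swapGen).prod) = ⊤ := by
  refine (Submodule.eq_top_iff').2 fun x ↦ ?_
  -- The span contains `1`, so stability under left multiplication, checked on generators, suffices.
  suffices h : ∀ y ∈ Submodule.span ℂ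
      (Set.range fun l : List (Fin (n - 1)) ↦ (l.map swapGen).prod), x * y ∈ Submodule.span ℂ
      (Set.range fun l : List (Fin (n - 1)) ↦ (l.map swapGen).prod) by
    rw [← mul_one x]
    exact h 1 (Submodule.subset_span ⟨[], rfl⟩)
  obtain ⟨a, rfl⟩ := RingQuot.mkAlgHom_surjective ℂ (TLRel ℂ 2 n) x
  induction a using FreeAlgebra.induction with
  | grade0 r =>
    intro y hy
    rw [AlgHom.commutes, ← Algebra.smul_def]
    exact Submodule.smul_mem _ r hy
  | grade1 i =>
    intro y hy
    change gen i * y ∈ _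
    rw [gen_eq_swapGen_add_one, add_mul, one_mul]
    refine add_mem ?_ hy
    induction hy using Submodule.span_induction with
    | mem x hx =>
      obtain ⟨l, rfl⟩ := hx
      exact Submodule.subset_span ⟨i :: l, by simp⟩
    | zero => simp
    | add x y _ _ hx hy => rw [mul_add]; exact add_mem hx hy
    | smul a x _ hx => rw [mul_smul_comm]; exact Submodule.smul_mem _ a hx
  | mul a b ha hb =>
    intro y hy
    rw [map_mul, mul_assoc]
    exact ha _ (hb _ hy)
  | add a b ha hb =>
    intro y hy
    rw [map_add, add_mul]
    exact add_mem (ha _ hy) (hb _ hy)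

theorem span_tElem : ⊤ ≤ Submodule.span ℂ (Set.range (tElem : Avoiding321 n → TL2 n)) := by
  rw [← span_swapGen_word, Submodule.span_le]
  rintro _ ⟨l, rfl⟩
  exact swapGen_word_mem_span _ l rfl

end Span

/-! ## The representation on functions of colourings -/

section Representation

/-- The action of `t_i` on functions of two-colourings of `[n]`. -/
noncomputable def genAct (i : Fin (n - 1)) : Module.End ℂ ((Fin n → Bool) → ℂ) where
  toFun F c := if c (lo i) = c (hi i) then 0 else F c + F (c ∘ adjSwap i)
  map_add' F G := by
    ext c
    simp only [Pi.add_apply]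
    split_ifs
    · simp
    · ring
  map_smul' a F := by
    ext c
    simp only [Pi.smul_apply, smul_eq_mul, RingHom.id_apply]
    split_ifs
    · simp
    · ring

theorem genAct_apply (i : Fin (n - 1)) (F : (Fin n → Bool) → ℂ) (c : Fin n → Bool) :
    genAct i F c = if c (lo i) = c (hi i) then 0 else F c + F (c ∘ adjSwap i) := rfl

theorem comp_adjSwap_of_eq {i : Fin (n - 1)} {c : Fin n → Bool} (h : c (lo i) = c (hi i)) :
    c ∘ adjSwap i = c := by
  ext x
  simp only [Function.comp_apply, adjSwap, Equiv.swap_apply_def]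
  split_ifs with h₁ h₂
  · rw [h₁, h]
  · rw [h₂, h]
  · rfl

theorem comp_adjSwap_adjSwap (i : Fin (n - 1)) (c : Fin n → Bool) :
    (c ∘ adjSwap i) ∘ adjSwap i = c := by
  ext x
  simp [adjSwap]

theorem genAct_sq (i : Fin (n - 1)) : genAct i * genAct i = (2 : ℂ) • genAct i := by
  refine LinearMap.ext fun F ↦ funext fun c ↦ ?_
  by_cases h : c (lo i) = c (hi i)
  · simp [genAct_apply, h]
  · have h' := Ne.symm h
    simp only [Module.End.mul_apply, LinearMap.smul_apply, Pi.smul_apply, genAct_apply, h,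
      if_false, comp_adjSwap_adjSwap, Function.comp_apply, adjSwap_lo, adjSwap_hi, h', smul_eq_mul]
    ring

theorem genAct_comm {i j : Fin (n - 1)} (h : Distant i j) :
    genAct i * genAct j = genAct j * genAct i := by
  have e₁ : adjSwap i (lo j) = lo j := by
    rcases h with h | h <;>
      exact adjSwap_apply_of_ne i (by simp only [lo]; omega) (by simp only [lo]; omega)
  have e₂ : adjSwap i (hi j) = hi j := by
    rcases h with h | h <;>
      exact adjSwap_apply_of_ne i (by simp only [hi]; omega) (by simp only [hi]; omega)
  have e₃ : adjSwap j (lo i) = lo i := by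
    rcases h with h | h <;>
      exact adjSwap_apply_of_ne j (by simp only [lo]; omega) (by simp only [lo]; omega)
  have e₄ : adjSwap j (hi i) = hi i := by
    rcases h with h | h <;>
      exact adjSwap_apply_of_ne j (by simp only [hi]; omega) (by simp only [hi]; omega)
  have e (c : Fin n → Bool) : (c ∘ adjSwap i) ∘ adjSwap j = (c ∘ adjSwap j) ∘ adjSwap i := by
    have : adjSwap i * adjSwap j = adjSwap j * adjSwap i := by
      rw [adjSwap, Equiv.swap_mul_eq_mul_swap, ← adjSwap]
      congr 1
      change Equiv.swap ((adjSwap j).symm (lo i)) ((adjSwap j).symm (hi i)) = adjSwap i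
      rw [Equiv.symm_apply_eq (adjSwap j) |>.2 e₃.symm, Equiv.symm_apply_eq (adjSwap j) |>.2 e₄.symm,
        adjSwap]
    ext x
    exact congrArg c (congrArg (fun p : Equiv.Perm (Fin n) ↦ p x) this)
  refine LinearMap.ext fun F ↦ funext fun c ↦ ?_
  simp only [Module.End.mul_apply, genAct_apply, Function.comp_apply, e₁, e₂, e₃, e₄, e]
  split_ifs <;> ring

/-- With two colours on three neighbouring positions, if `c` differs at the pair of `i`, exactly one
of `c` and `c ∘ adjSwap i` differs at the pair of `j` (`dich`). Swapping that one by `s_j` makes the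
pair of `i` equal (`key`), so this term vanishes and a single copy of `genAct i` remains. -/
theorem genAct_braid {i j : Fin (n - 1)} (h : Adjacent i j) :
    genAct i * genAct j * genAct i = genAct i := by
  refine LinearMap.ext fun F ↦ funext fun c ↦ ?_
  simp only [Module.End.mul_apply, genAct_apply]
  by_cases hc : c (lo i) = c (hi i)
  · simp [hc]
  have hs (c' : Fin n → Bool) (hc' : c' (lo i) ≠ c' (hi i)) :
      ((c' ∘ adjSwap i) (lo i) ≠ (c' ∘ adjSwap i) (hi i)) := by
    simpa [adjSwap_lo, adjSwap_hi] using hc'.symm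
  have key (c' : Fin n → Bool) (hc' : c' (lo i) ≠ c' (hi i)) (h' : c' (lo j) ≠ c' (hi j)) :
      (c' ∘ adjSwap j) (lo i) = (c' ∘ adjSwap j) (hi i) := by
    rcases h with h | h
    · have e : hi i = lo j := Fin.ext h
      rw [Function.comp_apply, Function.comp_apply, e, adjSwap_lo,
        adjSwap_apply_of_ne j (by simp only [lo]; omega) (by simp only [lo]; omega)]
      rw [e] at hc'
      revert hc' h'
      cases c' (lo i) <;> cases c' (lo j) <;> cases c' (hi j) <;> simp
    · have e : lo i = hi j := Fin.ext h.symm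
      rw [Function.comp_apply, Function.comp_apply, e, adjSwap_hi,
        adjSwap_apply_of_ne j (by simp only [hi]; omega) (by simp only [hi]; omega)]
      rw [e] at hc'
      revert hc' h'
      cases c' (hi i) <;> cases c' (lo j) <;> cases c' (hi j) <;> simp
  have dich (c' : Fin n → Bool) (hc' : c' (lo i) ≠ c' (hi i)) :
      (c' (lo j) = c' (hi j)) ↔ ¬ ((c' ∘ adjSwap i) (lo j) = (c' ∘ adjSwap i) (hi j)) := by
    rcases h with h | h
    · have e : hi i = lo j := Fin.ext h
      rw [Function.comp_apply, Function.comp_apply, ← e, adjSwap_hi,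
        adjSwap_apply_of_ne i (by simp only [hi]; omega) (by simp only [hi]; omega)]
      revert hc'
      cases c' (lo i) <;> cases c' (hi i) <;> cases c' (hi j) <;> simp
    · have e : lo i = hi j := Fin.ext h.symm
      rw [Function.comp_apply, Function.comp_apply, ← e, adjSwap_lo,
        adjSwap_apply_of_ne i (by simp only [lo]; omega) (by simp only [lo]; omega)]
      revert hc'
      cases c' (lo i) <;> cases c' (hi i) <;> cases c' (lo j) <;> simp
  have hc' := hs c hc
  rw [if_neg hc, if_neg hc', comp_adjSwap_adjSwap]
  by_cases hj : c (lo j) = c (hi j)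
  · have hj' := (dich c hc).1 hj
    rw [if_pos hj, if_neg hj', if_pos (key _ hc' hj'), if_neg hc]
    ring
  · have hj' := not_not.1 (mt (dich c hc).2 hj)
    rw [if_neg hj, if_pos hj', if_pos (key _ hc hj)]
    ring

/-- The representation of `TL_n(2)` on functions of two-colourings of `[n]`. -/
noncomputable def colourRep (n : ℕ) : TL2 n →ₐ[ℂ] Module.End ℂ ((Fin n → Bool) → ℂ) :=
  RingQuot.liftAlgHom ℂ ⟨FreeAlgebra.lift ℂ genAct, by
    intro x y h
    cases h with
    | sq i => simpa using genAct_sq i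
    | braid i j h => simpa using genAct_braid h
    | comm i j h => simpa using genAct_comm h⟩

theorem colourRep_gen (i : Fin (n - 1)) : colourRep n (gen i) = genAct i := by
  rw [colourRep, gen, RingQuot.liftAlgHom_mkAlgHom_apply, FreeAlgebra.lift_ι_apply]

theorem colourRep_swapGen_apply (i : Fin (n - 1)) (F : (Fin n → Bool) → ℂ) (c : Fin n → Bool) :
    colourRep n (swapGen i) F c =
      if c (lo i) = c (hi i) then -F c else F (c ∘ adjSwap i) := by
  rw [swapGen, map_sub, map_one, colourRep_gen, LinearMap.sub_apply, Pi.sub_apply, genAct_apply,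
    Module.End.one_apply]
  split_ifs <;> ring

/-- The matrix coefficient of the colouring representation at the colourings `c₀` and `c`. -/
noncomputable def colourCoeff (c₀ c : Fin n → Bool) : TL2 n →ₗ[ℂ] ℂ :=
  LinearMap.proj c ∘ₗ LinearMap.applyₗ (Pi.single c₀ (1 : ℂ)) ∘ₗ (colourRep n).toLinearMap

theorem colourCoeff_one (c₀ c : Fin n → Bool) :
    colourCoeff c₀ c 1 = if c = c₀ then 1 else 0 := by
  simp [colourCoeff, Pi.single_apply]

theorem colourCoeff_gen_mul (c₀ c : Fin n → Bool) (i : Fin (n - 1)) (x : TL2 n) :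
    colourCoeff c₀ c (gen i * x) = if c (lo i) = c (hi i) then 0 else
      colourCoeff c₀ c x + colourCoeff c₀ (c ∘ adjSwap i) x := by
  simp [colourCoeff, colourRep_gen, genAct_apply]

theorem colourCoeff_swapGen_mul (c₀ c : Fin n → Bool) (i : Fin (n - 1)) (x : TL2 n) :
    colourCoeff c₀ c (swapGen i * x) = if c (lo i) = c (hi i) then
      -colourCoeff c₀ c x else colourCoeff c₀ (c ∘ adjSwap i) x := by
  simp [colourCoeff, colourRep_swapGen_apply]

/-- A product of signed permutations has one nonzero entry per row. The case of equal colours fits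
in because the swap then fixes the colouring. -/
theorem colourCoeff_swapGen_word_of_ne (c₀ : Fin n → Bool) (l : List (Fin (n - 1))) :
    ∀ c, c ∘ wordProd l ≠ c₀ → colourCoeff c₀ c (l.map swapGen).prod = 0 := by
  induction l with
  | nil =>
    intro c hc
    rw [List.map_nil, List.prod_nil, colourCoeff_one]
    exact if_neg hc
  | cons i l ih =>
    intro c hc
    rw [wordProd_cons, Equiv.Perm.coe_mul, ← Function.comp_assoc] at hc
    rw [List.map_cons, List.prod_cons, colourCoeff_swapGen_mul, ih _ hc]
    split_ifs with h
    · rw [comp_adjSwap_of_eq h] at hc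
      rw [ih c hc, neg_zero]
    · rfl

theorem colourCoeff_swapGen_word_of_eq (c₀ : Fin n → Bool) (l : List (Fin (n - 1))) :
    ∀ c, c ∘ wordProd l = c₀ → colourCoeff c₀ c (l.map swapGen).prod = 1 ∨
      colourCoeff c₀ c (l.map swapGen).prod = -1 := by
  induction l with
  | nil =>
    intro c hc
    rw [List.map_nil, List.prod_nil, colourCoeff_one]
    exact Or.inl (if_pos hc)
  | cons i l ih =>
    intro c hc
    rw [wordProd_cons, Equiv.Perm.coe_mul, ← Function.comp_assoc] at hc
    rw [List.map_cons, List.prod_cons, colourCoeff_swapGen_mul]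
    split_ifs with h
    · rw [comp_adjSwap_of_eq h] at hc
      rcases ih c hc with e | e <;> simp [e]
    · exact ih _ hc

/-- The colouring by membership in a set. -/
def colouring (I : Finset (Fin n)) (x : Fin n) : Bool := decide (x ∈ I)

theorem colouring_injective : Function.Injective (colouring (n := n)) := by
  intro I J h
  ext x
  simpa [colouring] using congrFun h x

theorem colouring_comp_eq_iff {I J : Finset (Fin n)} (v : Equiv.Perm (Fin n)) :
    colouring J ∘ v = colouring I ↔ I.image v = J := by
  constructor
  · intro h
    ext x
    obtain ⟨y, rfl⟩ := v.surjective x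
    have := congrFun h y
    simp only [colouring, Function.comp_apply, decide_eq_decide] at this
    simp [this]
  · rintro rfl
    ext x
    simp [colouring]

/-- Matrix coefficients of the `t_u` that single out `t_w` among those with `u` not longer
than `w`. -/
theorem exists_colourCoeff_tElem (w : Avoiding321 n) : ∃ I J : Finset (Fin n),
    (colourCoeff (colouring I) (colouring J) (tElem w) = 1 ∨
      colourCoeff (colouring I) (colouring J) (tElem w) = -1) ∧
    ∀ u : Avoiding321 n, (redWord u.1).length ≤ (redWord w.1).length → u ≠ w →
      colourCoeff (colouring I) (colouring J) (tElem u) = 0 := by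
  obtain ⟨I, hI, hI'⟩ := w.2.exists_strictMonoOn
  -- Replacing each `t_i` by `t_i - 1` changes the product by shorter words, none of which maps `I`
  -- to `w(I)`, as `w` is shortest with this image.
  have lead (u : Avoiding321 n) (hu : (redWord u.1).length ≤ (redWord w.1).length) :
      colourCoeff (colouring I) (colouring (I.image w.1)) (tElem u) =
        colourCoeff (colouring I) (colouring (I.image w.1)) ((redWord u.1).map swapGen).prod := by
    rw [← sub_eq_zero, ← map_sub, ← LinearMap.mem_ker]
    refine Submodule.span_le.2 ?_ (gen_word_sub_mem (redWord u.1))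
    rintro _ ⟨l, hl, rfl⟩
    refine colourCoeff_swapGen_word_of_ne _ l _ fun hc ↦ ?_
    rw [colouring_comp_eq_iff] at hc
    have hlt : l.length < (redWord w.1).length := lt_of_lt_of_le hl hu
    rcases exists_word_of_image_eq hI hI' _ l le_rfl hc with e | ⟨l', hl', e⟩
    · exact absurd (redWord_length_le e) (by omega)
    · exact absurd (redWord_length_le e) (by omega)
  refine ⟨I, I.image w.1, ?_, fun u hu hne ↦ ?_⟩
  · rw [lead w le_rfl]
    exact colourCoeff_swapGen_word_of_eq _ _ _
      (by rw [wordProd_redWord]; exact (colouring_comp_eq_iff _).2 rfl)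
  · rw [lead u hu]
    refine colourCoeff_swapGen_word_of_ne _ _ _ fun hc ↦ ?_
    rw [colouring_comp_eq_iff] at hc
    rcases exists_word_of_image_eq hI hI' _ _ le_rfl hc with e | ⟨l', hl', e⟩
    · exact hne (Subtype.ext (by rw [← wordProd_redWord u.1, e]))
    · exact absurd (redWord_length_le e) (by omega)

/-- In a relation, the functional of a longest `w` with nonzero coefficient kills every other term.
-/
theorem linearIndependent_tElem : LinearIndependent ℂ (tElem : Avoiding321 n → TL2 n) := by
  rw [linearIndependent_iff']
  intro s a hs
  by_contra! hne
  obtain ⟨w₀, hw₀, ha₀⟩ := hne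
  classical
  obtain ⟨w, hw, hmax⟩ := (s.filter fun u ↦ a u ≠ 0).exists_max_image
    (fun u ↦ (redWord u.1).length) ⟨w₀, Finset.mem_filter.2 ⟨hw₀, ha₀⟩⟩
  obtain ⟨hws, haw⟩ := Finset.mem_filter.1 hw
  obtain ⟨I, J, h1, h0⟩ := exists_colourCoeff_tElem w
  have hsum := congrArg (colourCoeff (colouring I) (colouring J)) hs
  rw [map_sum, map_zero, Finset.sum_eq_single w] at hsum
  · rw [map_smul, smul_eq_mul] at hsum
    rcases h1 with h1 | h1 <;> rw [h1] at hsum <;> exact haw (by simpa using hsum)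
  · intro u hu huw
    rw [map_smul, smul_eq_mul]
    by_cases hau : a u = 0
    · rw [hau, zero_mul]
    · rw [h0 u (hmax u (Finset.mem_filter.2 ⟨hu, hau⟩)) huw, mul_zero]
  · exact fun h ↦ absurd hws h

theorem isTLBasis (n : ℕ) : IsTLBasis n := ⟨linearIndependent_tElem, span_tElem⟩

end Representation

/-! ## Matrix coefficients and diagrams -/

section Diagrams

/-- All pairs of the matching `m` have ends of different colours. -/
def IsAlternating {α : Type*} (m : α → α) (C : α → Bool) : Prop := ∀ a, C (m a) ≠ C a

/-! ### Alternating colourings under reconnection of a matching. -/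

section Matchings

variable {α : Type*} [DecidableEq α]

/-- The matching in which `p` and `q` are partners, as are their former partners. -/
def reconnect (p q : α) (m : α → α) (a : α) : α :=
  if a = p then q else if a = q then p else if m a = p then m q else if m a = q then m p else m a

/-- The colouring with the colours of `p` and `q` exchanged. -/
def exchange (p q : α) (C : α → Bool) (a : α) : Bool :=
  if a = p then C q else if a = q then C p else C a

variable {p q : α} {m : α → α} {C : α → Bool}

theorem reconnect_involutive (hpq : p ≠ q) (hm : ∀ a, m (m a) = a) (hm' : ∀ a, m a ≠ a) :
    (∀ a, reconnect p q m (reconnect p q m a) = a) ∧ ∀ a, reconnect p q m a ≠ a := by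
  have inj {a b : α} (h : m a = m b) : a = b := by rw [← hm a, h, hm]
  have hp := hm p
  have hq := hm q
  have hp' := hm' p
  have hq' := hm' q
  have hne : m p ≠ m q := fun h ↦ hpq (inj h)
  constructor <;> intro a <;> have h₁ := hm a <;> have h₂ := hm' a <;>
    have h₃ : m a = p → a = m p := (fun h ↦ by rw [← h, h₁]) <;>
    have h₄ : m a = q → a = m q := (fun h ↦ by rw [← h, h₁]) <;>
    have h₅ : m p = q → m q = p := (fun h ↦ by rw [← h, hp]) <;>
    clear hm hm' inj <;> simp only [reconnect] <;> grind

/-- The closed loop case: both terms of the action of `t_i` contribute equally, whence a factor of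
two. -/
theorem isAlternating_reconnect_of_partner (hm : ∀ a, m (m a) = a) (h : C p ≠ C q)
    (hpq : m p = q) :
    (IsAlternating m C ↔ IsAlternating (reconnect p q m) C) ∧
    (IsAlternating m (exchange p q C) ↔ IsAlternating (reconnect p q m) C) := by
  have hqp : m q = p := by rw [← hpq, hm]
  have hne : p ≠ q := fun e ↦ h (congrArg C e)
  constructor <;> refine forall_congr' fun a ↦ ?_ <;>
    have h₃ : m a = p → a = q := (fun h ↦ by rw [← hm a, h, hpq]) <;>
    have h₄ : m a = q → a = p := (fun h ↦ by rw [← hm a, h, hqp]) <;>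
    clear hm <;> simp only [reconnect, exchange] <;> grind

/-- The case without a loop: `m p` and `m q` must have different colours, so either both differ from
the colours of `p` and `q`, or both do after the exchange. By `IsAlternating.not_exchange` only one
of these happens, so no factor arises. -/
theorem isAlternating_reconnect_iff (hm : ∀ a, m (m a) = a) (hm' : ∀ a, m a ≠ a)
    (h : C p ≠ C q) (hpq : m p ≠ q) :
    IsAlternating (reconnect p q m) C ↔
      (IsAlternating m C ∨ IsAlternating m (exchange p q C)) := by
  have hne : p ≠ q := fun e ↦ h (congrArg C e)
  have hp := hm p
  have hq := hm q
  have hp' := hm' p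
  have hq' := hm' q
  have hqp : m q ≠ p := fun e ↦ hpq (by rw [← e, hm])
  have hmne : m p ≠ m q := fun e ↦ hne (by rw [← hm p, e, hm])
  have h₃ (a) : m a = p → a = m p := fun h ↦ by rw [← h, hm]
  have h₄ (a) : m a = q → a = m q := fun h ↦ by rw [← h, hm]
  clear hm hm'
  constructor
  · intro H
    have hC : C (m q) ≠ C (m p) := by
      have := H (m p)
      rwa [reconnect, if_neg hp', if_neg hpq, if_pos hp] at this
    have Ha (a) (e₁ : a ≠ p) (e₂ : a ≠ q) (e₃ : a ≠ m p) (e₄ : a ≠ m q) : C (m a) ≠ C a := by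
      have := H a
      rwa [reconnect, if_neg e₁, if_neg e₂, if_neg (mt (h₃ a) e₃), if_neg (mt (h₄ a) e₄)] at this
    clear H
    have hC' : C (m p) = C p ↔ C (m q) = C q := by
      revert h hC
      cases C p <;> cases C q <;> cases C (m p) <;> cases C (m q) <;> simp
    by_cases hCp : C (m p) = C p
    · right
      intro a
      have h₃ := h₃ a
      have h₄ := h₄ a
      have Ha := Ha a
      by_cases e₁ : a = p <;> by_cases e₂ : a = q <;> by_cases e₃ : a = m p <;>
        by_cases e₄ : a = m q <;> simp only [exchange] <;> grind
    · left
      intro a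
      have Ha := Ha a
      by_cases e₁ : a = p <;> by_cases e₂ : a = q <;> by_cases e₃ : a = m p <;>
        by_cases e₄ : a = m q <;> grind
  · rintro (H | H) a
    · have Ha := H a
      have Hp := H p
      have Hq := H q
      have h₃ := h₃ a
      have h₄ := h₄ a
      have hC : C (m q) ≠ C (m p) := by
        revert h Hp Hq
        cases C p <;> cases C q <;> cases C (m p) <;> cases C (m q) <;> simp
      clear H
      simp only [reconnect]
      grind
    · have Ha := H a
      have Hp := H p
      have Hq := H q
      have h₃ := h₃ a
      have h₄ := h₄ a
      clear H
      simp only [exchange, hp', hpq, hqp, hq', hne.symm, if_true, if_false] at Hp Hq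
      simp only [exchange] at Ha
      have hC : C (m q) ≠ C (m p) := by
        revert h Hp Hq
        cases C p <;> cases C q <;> cases C (m p) <;> cases C (m q) <;> simp
      simp only [reconnect]
      grind

theorem IsAlternating.not_exchange (hm' : ∀ a, m a ≠ a) (h : C p ≠ C q) (hpq : m p ≠ q)
    (H : IsAlternating m C) : ¬ IsAlternating m (exchange p q C) := by
  intro H'
  have h₁ := H p
  have h₂ := H' p
  simp only [exchange, if_neg (hm' p), if_neg hpq, if_true] at h₂
  revert h h₁ h₂
  cases C p <;> cases C q <;> cases C (m p) <;> simp

end Matchings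

/-! ### Coloured vertices and the diagrams of words. -/

theorem leftVertex_inj {x y : Fin n} : leftVertex x = leftVertex y ↔ x = y := by
  simp only [leftVertex, Fin.ext_iff]

theorem rightVertex_inj {x y : Fin n} : rightVertex x = rightVertex y ↔ x = y := by
  rw [rightVertex, rightVertex, Fin.rev_inj, leftVertex_inj]

theorem leftVertex_ne_rightVertex (x y : Fin n) : leftVertex x ≠ rightVertex y := fun h ↦ by
  have := congrArg Fin.val h
  simp only [rightVertex, leftVertex, Fin.val_rev] at this
  omega

theorem leftVertex_lo_ne_hi (i : Fin (n - 1)) : leftVertex (lo i) ≠ leftVertex (hi i) :=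
  fun h ↦ lo_ne_hi i (leftVertex_inj.1 h)

theorem matching_involutive (l : List (Fin (n - 1))) :
    (∀ a, matching l (matching l a) = a) ∧ ∀ a, matching l a ≠ a := by
  induction l with
  | nil =>
    refine ⟨Fin.rev_rev, fun a h ↦ ?_⟩
    have := congrArg Fin.val h
    simp only [matching, Fin.val_rev] at this
    omega
  | cons i l ih =>
    exact reconnect_involutive (leftVertex_lo_ne_hi i) ih.1 ih.2

/-- The colouring of the vertices of a diagram by `c` on the left and by the opposite of `c₀` on
the right. -/
def vertexColouring (c₀ c : Fin n → Bool) (a : Fin (2 * n)) : Bool :=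
  if h : a.1 < n then c ⟨a.1, h⟩ else !c₀ ⟨2 * n - 1 - a.1, by omega⟩

theorem vertexColouring_leftVertex (c₀ c : Fin n → Bool) (x : Fin n) :
    vertexColouring c₀ c (leftVertex x) = c x := by
  simp [vertexColouring, leftVertex]

theorem vertexColouring_rightVertex (c₀ c : Fin n → Bool) (x : Fin n) :
    vertexColouring c₀ c (rightVertex x) = !c₀ x := by
  have h₁ : ¬ (2 * n - (x.1 + 1) < n) := by omega
  have h₂ : 2 * n - 1 - (2 * n - (x.1 + 1)) = x.1 := by omega
  simp [vertexColouring, rightVertex, leftVertex, Fin.val_rev, h₁, h₂]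

theorem eq_leftVertex_or_eq_rightVertex (a : Fin (2 * n)) :
    (∃ x, a = leftVertex x) ∨ ∃ x, a = rightVertex x := by
  by_cases h : a.1 < n
  · exact Or.inl ⟨⟨a.1, h⟩, rfl⟩
  · refine Or.inr ⟨⟨2 * n - 1 - a.1, by omega⟩, Fin.ext ?_⟩
    simp only [rightVertex, leftVertex, Fin.val_rev]
    omega

theorem isAlternating_nil (c₀ c : Fin n → Bool) :
    IsAlternating (matching []) (vertexColouring c₀ c) ↔ c = c₀ := by
  constructor
  · intro h
    ext x
    have := h (leftVertex x)
    change vertexColouring c₀ c (rightVertex x) ≠ _ at this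
    rw [vertexColouring_rightVertex, vertexColouring_leftVertex] at this
    revert this
    cases c x <;> cases c₀ x <;> simp
  · rintro rfl a
    rcases eq_leftVertex_or_eq_rightVertex a with ⟨x, rfl⟩ | ⟨x, rfl⟩
    · change vertexColouring c c (rightVertex x) ≠ _
      rw [vertexColouring_rightVertex, vertexColouring_leftVertex]
      simp
    · have : matching [] (rightVertex x) = leftVertex x := Fin.rev_rev _
      rw [this, vertexColouring_rightVertex, vertexColouring_leftVertex]
      simp

theorem vertexColouring_comp_adjSwap (c₀ c : Fin n → Bool) (i : Fin (n - 1)) :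
    vertexColouring c₀ (c ∘ adjSwap i) =
      exchange (leftVertex (lo i)) (leftVertex (hi i)) (vertexColouring c₀ c) := by
  ext a
  simp only [exchange]
  rcases eq_leftVertex_or_eq_rightVertex a with ⟨x, rfl⟩ | ⟨x, rfl⟩
  · simp only [vertexColouring_leftVertex, Function.comp_apply, adjSwap, Equiv.swap_apply_def,
      leftVertex_inj]
    split_ifs <;> rfl
  · rw [if_neg (leftVertex_ne_rightVertex _ _).symm, if_neg (leftVertex_ne_rightVertex _ _).symm,
      vertexColouring_rightVertex, vertexColouring_rightVertex]

theorem not_isAlternating_attach {i : Fin (n - 1)} {m : Fin (2 * n) → Fin (2 * n)}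
    {c₀ c : Fin n → Bool} (h : c (lo i) = c (hi i)) :
    ¬ IsAlternating (attach i m) (vertexColouring c₀ c) := by
  intro H
  have := H (leftVertex (lo i))
  rw [attach, if_pos rfl, vertexColouring_leftVertex, vertexColouring_leftVertex] at this
  exact this h.symm

open Classical in
/-- A matrix coefficient of a product of the `t_i` is a power of two if the diagram is compatible
with the colourings, and vanishes otherwise. -/
theorem exists_colourCoeff_gen_word (l : List (Fin (n - 1))) : ∃ k : ℕ, ∀ c₀ c : Fin n → Bool,
    colourCoeff c₀ c (l.map gen).prod =
      if IsAlternating (matching l) (vertexColouring c₀ c) then 2 ^ k else 0 := by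
  induction l with
  | nil =>
    refine ⟨0, fun c₀ c ↦ ?_⟩
    rw [List.map_nil, List.prod_nil, colourCoeff_one, pow_zero]
    simp only [isAlternating_nil]
  | cons i l ih =>
    obtain ⟨k, hk⟩ := ih
    obtain ⟨hm, hm'⟩ := matching_involutive l
    have hcol {c₀ c : Fin n → Bool} (h : c (lo i) ≠ c (hi i)) :
        vertexColouring c₀ c (leftVertex (lo i)) ≠ vertexColouring c₀ c (leftVertex (hi i)) := by
      rwa [vertexColouring_leftVertex, vertexColouring_leftVertex]
    have hattach : attach i (matching l) =
      reconnect (leftVertex (lo i)) (leftVertex (hi i)) (matching l) := rfl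
    -- The exponent counts closed loops. Whether one arises depends on the matching only, so `k` is
    -- uniform in the colourings.
    by_cases hloop : matching l (leftVertex (lo i)) = leftVertex (hi i)
    · refine ⟨k + 1, fun c₀ c ↦ ?_⟩
      rw [List.map_cons, List.prod_cons, colourCoeff_gen_mul, matching]
      by_cases h : c (lo i) = c (hi i)
      · rw [if_pos h, if_neg (not_isAlternating_attach h)]
      · obtain ⟨e₁, e₂⟩ := isAlternating_reconnect_of_partner hm (hcol (c₀ := c₀) h) hloop
        rw [if_neg h, hk, hk, vertexColouring_comp_adjSwap, hattach]
        simp only [e₁, e₂]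
        split_ifs
        · rw [pow_succ, mul_two]
        · rw [add_zero]
    · refine ⟨k, fun c₀ c ↦ ?_⟩
      rw [List.map_cons, List.prod_cons, colourCoeff_gen_mul, matching]
      by_cases h : c (lo i) = c (hi i)
      · rw [if_pos h, if_neg (not_isAlternating_attach h)]
      · have hiff := isAlternating_reconnect_iff hm hm' (hcol (c₀ := c₀) h) hloop
        have hnot := IsAlternating.not_exchange hm' (hcol (c₀ := c₀) h) hloop
        rw [if_neg h, hk, hk, vertexColouring_comp_adjSwap, hattach]
        simp only [hiff]
        by_cases H : IsAlternating (matching l) (vertexColouring c₀ c)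
        · rw [if_pos H, if_neg (hnot H), if_pos (Or.inl H), add_zero]
        · simp only [H, if_false, false_or, zero_add]

theorem mem_colourSet_iff (I J : Finset (Fin n)) (a : Fin (2 * n)) :
    a ∈ colourSet I J ↔ vertexColouring (colouring I) (colouring J) a = true := by
  rcases eq_leftVertex_or_eq_rightVertex a with ⟨x, rfl⟩ | ⟨x, rfl⟩
  · simp [colourSet, vertexColouring_leftVertex, colouring, leftVertex_inj,
      (leftVertex_ne_rightVertex _ _).symm]
  · simp [colourSet, vertexColouring_rightVertex, colouring, rightVertex_inj,
      leftVertex_ne_rightVertex]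

theorem isCompatible_iff (I J : Finset (Fin n)) (w : Avoiding321 n) :
    IsCompatible (colourSet I J) w ↔
      IsAlternating (matching (redWord w.1)) (vertexColouring (colouring I) (colouring J)) := by
  refine forall_congr' fun a ↦ ?_
  rw [mem_colourSet_iff, mem_colourSet_iff]
  cases vertexColouring (colouring I) (colouring J) a <;>
    cases vertexColouring (colouring I) (colouring J) (matching (redWord w.1) a) <;> simp

open Classical in
-- The diagram of `t_w` has no closed loops: its exponent of two does not depend on the colourings,
-- and some coefficient of `t_w` is `1` or `-1`.
theorem colourCoeff_tElem (I J : Finset (Fin n)) (w : Avoiding321 n) :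
    colourCoeff (colouring I) (colouring J) (tElem w) =
      if IsCompatible (colourSet I J) w then 1 else 0 := by
  obtain ⟨k, hk⟩ := exists_colourCoeff_gen_word (redWord w.1)
  obtain ⟨I', J', h, -⟩ := exists_colourCoeff_tElem w
  have hk0 : k = 0 := by
    rw [tElem, hk] at h
    split_ifs at h with H
    · by_contra hk0
      have h1 : (1 : ℝ) < 2 ^ k := one_lt_pow₀ one_lt_two hk0
      rcases h with h | h
      · have h' : ((2 : ℝ) ^ k : ℝ) = 1 := by exact_mod_cast h
        linarith
      · have h' : ((2 : ℝ) ^ k : ℝ) = -1 := by exact_mod_cast h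
        linarith
    · simp at h
  rw [tElem, hk, hk0, pow_zero]
  simp only [isCompatible_iff]

end Diagrams

/-! ## Products of complementary minors -/

section Minors

/-- The enumeration of `[n]` that lists a set in increasing order, and then its complement. -/
abbrev sumEnum {p q : ℕ} (J : Finset (Fin n)) (hp : J.card = p) (hq : Jᶜ.card = q) :
    Fin p ⊕ Fin q ≃ Fin n := finSumEquivOfFinset hp hq

/-- On a set not containing both `i` and `i + 1`, `s_i` is increasing, so it carries the increasing
enumeration to that of the image. -/
theorem adjSwap_comp_orderEmbOfFin {p : ℕ} {i : Fin (n - 1)} {J K : Finset (Fin n)}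
    (h : ¬ (lo i ∈ J ∧ hi i ∈ J)) (hK : J.image (adjSwap i) = K) (hp : J.card = p)
    (hp' : K.card = p) (x : Fin p) :
    adjSwap i (J.orderEmbOfFin hp x) = K.orderEmbOfFin hp' x := by
  refine congrFun (Finset.orderEmbOfFin_unique hp' (f := fun x ↦ adjSwap i (J.orderEmbOfFin hp x))
    (fun x ↦ ?_) fun x y hxy ↦ ?_) x
  · rw [← hK]
    exact Finset.mem_image_of_mem _ (J.orderEmbOfFin_mem hp x)
  · rcases adjSwap_lt_or i ((J.orderEmbOfFin hp).strictMono hxy) with h' | ⟨h₁, h₂⟩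
    · exact h'
    · exact absurd ⟨h₁ ▸ J.orderEmbOfFin_mem hp x, h₂ ▸ J.orderEmbOfFin_mem hp y⟩ h

/-- The matrix coefficients of the colouring representation on the images of permutations. -/
theorem colourCoeff_swapGen_word {p q : ℕ} (I : Finset (Fin n)) (hIp : I.card = p)
    (hIq : Iᶜ.card = q) (l : List (Fin (n - 1))) :
    ∀ (J : Finset (Fin n)) (hp : J.card = p) (hq : Jᶜ.card = q), I.image (wordProd l) = J →
      colourCoeff (colouring I) (colouring J) (l.map swapGen).prod =
        ((Equiv.Perm.sign (((sumEnum I hIp hIq).trans (wordProd l)).trans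
          (sumEnum J hp hq).symm) : ℤ) : ℂ) := by
  induction l with
  | nil =>
    intro J hp hq h
    obtain rfl : I = J := by simpa [wordProd] using h
    have : ((sumEnum I hIp hIq).trans (wordProd [])).trans (sumEnum I hp hq).symm = 1 := by
      ext x
      simp [wordProd]
    rw [this, List.map_nil, List.prod_nil, colourCoeff_one, if_pos rfl]
    simp
  | cons i l ih =>
    intro J hp hq h
    rw [List.map_cons, List.prod_cons, colourCoeff_swapGen_mul]
    have hcol : colouring J (lo i) = colouring J (hi i) ↔ (lo i ∈ J ↔ hi i ∈ J) := by
      simp [colouring]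
    have himage : I.image (wordProd l) = J.image (adjSwap i) := by
      rw [← h, wordProd_cons, Equiv.Perm.coe_mul, Finset.image_image, ← Function.comp_assoc,
        ← Equiv.Perm.coe_mul, adjSwap, Equiv.swap_mul_self]
      rfl
    have hcomp : colouring J ∘ adjSwap i = colouring (J.image (adjSwap i)) := by
      rw [colouring_comp_eq_iff, Finset.image_image, ← Equiv.Perm.coe_mul, adjSwap,
        Equiv.swap_mul_self, Equiv.Perm.coe_one, Finset.image_id]
    split_ifs with hc
    -- Equal colours: `s_i` preserves `J`, and the permutation of positions gains a conjugate of
    -- `s_i`, whose sign is the `-1` of the action.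
    · have hJ : J.image (adjSwap i) = J := by
        rw [comp_adjSwap_of_eq hc] at hcomp
        exact (colouring_injective hcomp).symm
      rw [ih J hp hq (himage.trans hJ)]
      have : ((sumEnum I hIp hIq).trans (wordProd (i :: l))).trans (sumEnum J hp hq).symm =
          (((sumEnum J hp hq).trans (adjSwap i)).trans (sumEnum J hp hq).symm) *
          (((sumEnum I hIp hIq).trans (wordProd l)).trans (sumEnum J hp hq).symm) := by
        ext x
        simp [wordProd_cons]
      rw [this, Equiv.Perm.sign_mul, Equiv.Perm.sign_trans_trans_symm, adjSwap,
        Equiv.Perm.sign_swap (lo_ne_hi i)]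
      simp
    -- Different colours: `s_i` matches the enumerations of `J` and its image, so the permutation of
    -- positions is unchanged.
    · rw [hcol] at hc
      have hK : (J.image (adjSwap i)).card = p := by
        rw [Finset.card_image_of_injective _ (adjSwap i).injective, hp]
      have hK' : (J.image (adjSwap i))ᶜ.card = q := by
        rw [← image_compl_perm, Finset.card_image_of_injective _ (adjSwap i).injective, hq]
      rw [hcomp, ih _ hK hK' himage]
      have e : sumEnum (J.image (adjSwap i)) hK hK' = (sumEnum J hp hq).trans (adjSwap i) := by
        ext1 x
        rcases x with x | x
        · rw [Equiv.trans_apply, finSumEquivOfFinset_inl, finSumEquivOfFinset_inl]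
          exact (adjSwap_comp_orderEmbOfFin (by tauto) rfl hp hK x).symm
        · rw [Equiv.trans_apply, finSumEquivOfFinset_inr, finSumEquivOfFinset_inr]
          exact (adjSwap_comp_orderEmbOfFin (by simp only [Finset.mem_compl]; tauto)
            (image_compl_perm _ _) hq hK' x).symm
      have e' : ((sumEnum I hIp hIq).trans (wordProd (i :: l))).trans (sumEnum J hp hq).symm =
          ((sumEnum I hIp hIq).trans (wordProd l)).trans
            (sumEnum (J.image (adjSwap i)) hK hK').symm := by
        rw [e]
        ext x
        simp [wordProd_cons, adjSwap]
      rw [e']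

open Classical in
theorem colourCoeff_theta (I J : Finset (Fin n)) {p q : ℕ} (hIp : I.card = p)
    (hIq : Iᶜ.card = q) (hJp : J.card = p) (hJq : Jᶜ.card = q) (v : Equiv.Perm (Fin n)) :
    colourCoeff (colouring I) (colouring J) (theta v) = if I.image v = J then
      ((Equiv.Perm.sign (((sumEnum I hIp hIq).trans v).trans (sumEnum J hJp hJq).symm) : ℤ) : ℂ)
      else 0 := by
  have htheta : theta v = ((redWord v).map swapGen).prod := rfl
  rw [htheta]
  split_ifs with h
  · have := colourCoeff_swapGen_word I hIp hIq (redWord v) J hJp hJq (by rwa [wordProd_redWord])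
    rwa [wordProd_redWord] at this
  · exact colourCoeff_swapGen_word_of_ne _ _ _
      (by rwa [Ne, colouring_comp_eq_iff, wordProd_redWord])

variable {R : Type*} [CommRing R]

theorem mem_sumEnum_iff {p q : ℕ} (J : Finset (Fin n)) (hp : J.card = p) (hq : Jᶜ.card = q)
    (x : Fin p ⊕ Fin q) : sumEnum J hp hq x ∈ J ↔ x.isLeft = true := by
  rcases x with x | x
  · simp [finSumEquivOfFinset_inl]
  · have := Jᶜ.orderEmbOfFin_mem hq x
    rw [Finset.mem_compl] at this
    simp [finSumEquivOfFinset_inr, this]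

open Classical in
/-- Laplace-type expansion of a product of complementary minors. -/
theorem minor_mul_minor_compl (X : Matrix (Fin n) (Fin n) R) (I J : Finset (Fin n))
    (h : I.card = J.card) (h' : Iᶜ.card = Jᶜ.card) :
    minor X I J h * minor X Iᶜ Jᶜ h' = ∑ v : Equiv.Perm (Fin n), if I.image v = J then
      ((Equiv.Perm.sign (((sumEnum I rfl rfl).trans v).trans
        (sumEnum J h.symm h'.symm).symm) : ℤ) : R) * ∏ i, X i (v i) else 0 := by
  -- The product is the determinant of a block diagonal matrix. The transpose makes the permutation
  -- act on column indices.
  rw [minor, minor, ← Matrix.det_fromBlocks_zero₂₁ _ 0, ← Matrix.det_transpose,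
    Matrix.det_apply']
  let e : Equiv.Perm (Fin I.card ⊕ Fin Iᶜ.card) ≃ Equiv.Perm (Fin n) :=
    Equiv.equivCongr (sumEnum I rfl rfl) (sumEnum J h.symm h'.symm)
  refine Fintype.sum_equiv e _ _ fun σ ↦ ?_
  have hσ : ((sumEnum I rfl rfl).trans (e σ)).trans (sumEnum J h.symm h'.symm).symm = σ := by
    ext1 x
    simp [e]
  have heσ (x) : e σ (sumEnum I rfl rfl x) = sumEnum J h.symm h'.symm (σ x) := by simp [e]
  rw [hσ]
  split_ifs with hI
  · congr 1
    rw [← (sumEnum I rfl rfl).prod_comp]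
    refine Finset.prod_congr rfl fun x _ ↦ ?_
    have hx : sumEnum J h.symm h'.symm (σ x) ∈ J ↔ sumEnum I rfl rfl x ∈ I := by
      rw [← heσ, ← (e σ).injective.mem_finset_image (s := I), hI]
    rw [mem_sumEnum_iff, mem_sumEnum_iff] at hx
    rw [heσ, Matrix.transpose_apply]
    rcases x with x | x <;> rcases hy : σ _ with y | y <;> simp [hy] at hx ⊢
  -- If `I` is not mapped onto `J`, then `σ` mixes the blocks and its product contains an entry of a
  -- zero block.
  · obtain ⟨x, hx⟩ : ∃ x, ¬ (x.isLeft = true ↔ (σ x).isLeft = true) := by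
      by_contra! H
      apply hI
      ext y
      obtain ⟨x, rfl⟩ := (e σ).surjective y
      obtain ⟨z, rfl⟩ := (sumEnum I rfl rfl).surjective x
      rw [(e σ).injective.mem_finset_image, heσ, mem_sumEnum_iff, mem_sumEnum_iff]
      exact H z
    rw [Finset.prod_eq_zero (Finset.mem_univ x), mul_zero]
    rw [Matrix.transpose_apply]
    rcases x with x | x <;> rcases hy : σ _ with y | y <;> simp [hy] at hx ⊢

end Minors

/-! ### Comparison of the two evaluations. -/

theorem tlCoeff_eq (w : Avoiding321 n) (v : Equiv.Perm (Fin n)) :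
    tlCoeff w v = (Module.Basis.mk (isTLBasis n).1 (isTLBasis n).2).repr (theta v) w :=
  dif_pos (isTLBasis n)

/-- Evaluating the functional on the expansion of `theta v` keeps exactly the coefficients of the
compatible `t_w`, each with weight one. -/
theorem sum_tlCoeff (I J : Finset (Fin n)) (v : Equiv.Perm (Fin n)) :
    ∑ w ∈ Theta (colourSet I J), tlCoeff w v =
      colourCoeff (colouring I) (colouring J) (theta v) := by
  classical
  have : Fintype (Avoiding321 n) := Fintype.ofFinite _
  conv_rhs => rw [← (Module.Basis.mk (isTLBasis n).1 (isTLBasis n).2).sum_repr (theta v)]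
  simp only [map_sum, map_smul, Module.Basis.mk_apply, colourCoeff_tElem, smul_eq_mul, mul_ite,
    mul_one, mul_zero, ← tlCoeff_eq]
  rw [← Finset.sum_filter]
  refine Finset.sum_congr ?_ fun _ _ ↦ rfl
  ext w
  simp [Theta]

end TLImm

theorem mainTheorem10 (n : ℕ) {R : Type*} [CommRing R] [Algebra ℂ R]
    (X : Matrix (Fin n) (Fin n) R) (I J : Finset (Fin n)) (h : I.card = J.card) :
    TLImm.IsTLBasis n ∧
      TLImm.minor X I J h * TLImm.minor X Iᶜ Jᶜ (TLImm.card_compl_eq h) =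
        ∑ w ∈ TLImm.Theta (TLImm.colourSet I J), TLImm.tlImm X w := by
  refine ⟨TLImm.isTLBasis n, ?_⟩
  simp only [TLImm.tlImm]
  -- With the sum over `v` outermost, the two sides are compared monomial by monomial.
  rw [Finset.sum_comm, TLImm.minor_mul_minor_compl]
  refine Finset.sum_congr rfl fun v _ ↦ ?_
  rw [← Finset.sum_smul, TLImm.sum_tlCoeff, TLImm.colourCoeff_theta I J rfl rfl h.symm
    (TLImm.card_compl_eq h).symm]
  split_ifs
  · rw [Algebra.smul_def, map_intCast]
  · rw [zero_smul]
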